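/- All graphs are finite and simple. A graph is \emph{maximal planar} if it is planar but adding an edge between any two distinct non-adjacent vertices destroys planarity; a \emph{maximal plane graph} is a maximal planar graph together with an embedding of it in the plane. For a graph $G$ let $d_G$ denote the distance, let $e_G(u)=\max_{x\in V(G)} d_G(u,x)$ be the eccentricity of the vertex $u$, and let $\mathcal{E}_G(\alpha)=\{u\in V(G): e_G(u)=\alpha\}$. For a set $S$ of vertices of $G$, the set of \emph{quasi-eccentric vertices} of $S$ is $$\operatorname{qcc}_G(S)=\{u\in V(G) : \text{for every } v\in V(G) \text{ there is } s\in S \text{ with } d_G(u,s)\ge d_G(v,s)\}.$$ For a face $f$ of a plane graph $H$, write $\operatorname{qcc}_H(H[f])$ for $\operatorname{qcc}_H(S)$, where $S$ is the set of vertices on the boundary of $f$. \textbf{Theorem (quasi-eccentric face criterion in maximal planar graphs).} Let $H$ be a maximal plane graph of diameter $d$, and let $\alpha\ge d$ be an integer. Then $H$ is a (plane) subgraph of some maximal plane graph $G$ such that $V(H)\subseteq \mathcal{E}_G(\alpha)$ if and only if for every vertex $u$ of $H$ with $e_H(u)<\alpha$ there exists a face $f$ of $H$ such that $u\in\operatorname{qcc}_H(H[f])$.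 In the formal statement, embeddings in the plane are considered up to orientation-preserving homeomorphism of the sphere and are given by rotation systems of genus zero (combinatorial maps), whose faces are the cycles of face tracing. A plane subgraph carries the rotation system induced by that of the larger graph. -/

import Mathlib

universe u

/-- A rotation system on a simple graph: at every vertex, a cyclic order of the edges at that
vertex. A dart is an edge with a direction; the darts with first vertex `v` represent the edges
at `v`, and `next` sends each of them to the following one in the cyclic order around `v`.
Up to orientation-preserving homeomorphism, the rotation systems of a connected graph are its
cellular drawings in closed oriented surfaces (`next` is "the next edge anticlockwise"). -/
structure RotationSystem {V : Type u} (G : SimpleGraph V) where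
  /-- The successor in the cyclic order around the first vertex. -/
  next : Equiv.Perm G.Dart
  /-- The successor is a dart at the same vertex. -/
  fst_next : ∀ d, (next d).fst = d.fst
  /-- All darts at a vertex form a single cycle. -/
  sameCycle_next : ∀ d e : G.Dart, d.fst = e.fst → next.SameCycle d e

namespace RotationSystem

variable {V : Type u} {G : SimpleGraph V} (R : RotationSystem G)

/-- Face tracing: having walked along the dart `u → v`, leave `v` by the dart that follows
`v → u` in the cyclic order around `v`. -/
def faceNext : Equiv.Perm G.Dart :=
  (Function.Involutive.toPerm SimpleGraph.Dart.symm SimpleGraph.Dart.symm_involutive).trans R.next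

/-- The facial walks: the cycles of face tracing and, for every isolated vertex, the trivial walk
at that vertex. If the graph is connected and nonempty, these are the faces of the drawing
(the one-vertex graph has a single face, bounded by its vertex). -/
def Face : Type u :=
  Quotient (Equiv.Perm.SameCycle.setoid R.faceNext) ⊕ {v : V // ∀ w, ¬ G.Adj v w}

/-- The set of vertices on the boundary of a face. -/
def boundary : R.Face → Set V
  | Sum.inl q => {v | ∃ d : G.Dart, Quotient.mk _ d = q ∧ d.fst = v}
  | Sum.inr v => {v.1}

/-- The rotation system has genus zero, so that it is that of a drawing in the sphere, or
equivalently in the plane. Every component, drawn by itself in an oriented surface of genus `g`,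
satisfies `|V| - |E| + |F| = 2 - 2g` with `g ≥ 0`; so the drawings of all the components are in
the sphere if and only if `|V| - |E| + |F|` is twice the number of components. -/
def IsPlane [Finite V] : Prop :=
  Nat.card V + Nat.card R.Face = Nat.card G.edgeSet + 2 * Nat.card G.ConnectedComponent

end RotationSystem

/-- A finite simple graph is planar if it has a drawing in the plane. -/
def IsPlanar {V : Type u} [Finite V] (G : SimpleGraph V) : Prop :=
  ∃ R : RotationSystem G, R.IsPlane

/-- A finite simple graph is maximal planar if it is planar and the addition of any edge between
two distinct nonadjacent vertices destroys planarity. -/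
def IsMaximalPlanar {V : Type u} [Finite V] (G : SimpleGraph V) : Prop :=
  IsPlanar G ∧ ∀ u v : V, u ≠ v → ¬ G.Adj u v → ¬ IsPlanar (G ⊔ SimpleGraph.edge u v)

/-- A maximal plane graph: a maximal planar graph together with a plane embedding of it, given by
its rotation system. -/
structure MaximalPlaneGraph (V : Type u) [Finite V] where
  /-- The underlying abstract graph. -/
  graph : SimpleGraph V
  /-- The embedding. -/
  rot : RotationSystem graph
  isPlane : rot.IsPlane
  isMaximalPlanar : IsMaximalPlanar graph

/-- `ι` realizes the embedded graph `(H, R)` as a subgraph of the embedded graph `(G, S)`: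
`ι` identifies `H` with a subgraph of the abstract graph `G`, and the drawing of `H` is what is
left of the drawing of `G`. That is, around each vertex of `H`, the edge of `H` that follows a
given edge of `H` is the first edge of `H` that is met after it in the cyclic order of `G`. -/
def IsEmbeddedSubgraph {V W : Type u} {H : SimpleGraph V} {G : SimpleGraph W}
    (R : RotationSystem H) (S : RotationSystem G) (ι : SimpleGraph.Copy H G) : Prop :=
  ∀ d : H.Dart, ∃ k : ℕ, 0 < k ∧
    (S.next ^ k) (ι.toHom.mapDart d) = ι.toHom.mapDart (R.next d) ∧
    ∀ j : ℕ, 0 < j → j < k → (S.next ^ j) (ι.toHom.mapDart d) ∉ Set.range ι.toHom.mapDart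

/-- The set of quasi-eccentric vertices of a set `S` of vertices of `G`: those `u` such that for
every vertex `v` there is `s ∈ S` with `d(u, s) ≥ d(v, s)`. -/
def quasiEccentric {V : Type u} (G : SimpleGraph V) (S : Set V) : Set V :=
  {u | ∀ v : V, ∃ s ∈ S, G.edist v s ≤ G.edist u s}

namespace RotationSystem

section Rho

variable {V : Type u} {G : SimpleGraph V} (R : RotationSystem G)

open Classical in
/-- The neighbor of `v` that follows `w` in the cyclic order around `v`. -/
noncomputable def rho (v w : V) : V :=
  if h : G.Adj v w then (R.next ⟨(v, w), h⟩).snd else w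

theorem next_eq (d : G.Dart) : (R.next d).toProd = (d.fst, R.rho d.fst d.snd) := by
  have h : R.rho d.fst d.snd = (R.next d).snd := by
    unfold rho
    rw [dif_pos d.adj]
  rw [h, ← R.fst_next d]

theorem adj_rho {v w : V} (h : G.Adj v w) : G.Adj v (R.rho v w) := by
  have h1 := (R.next ⟨(v, w), h⟩).adj
  rwa [R.next_eq] at h1

theorem next_mk {v w : V} (h : G.Adj v w) :
    R.next ⟨(v, w), h⟩ = ⟨(v, R.rho v w), R.adj_rho h⟩ :=
  SimpleGraph.Dart.ext _ _ (R.next_eq _)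

theorem rho_inj {v w w' : V} (h : G.Adj v w) (h' : G.Adj v w') (e : R.rho v w = R.rho v w') :
    w = w' := by
  have : R.next ⟨(v, w), h⟩ = R.next ⟨(v, w'), h'⟩ := by
    rw [next_mk, next_mk]
    simp [e]
  simpa using R.next.injective this

theorem faceNext_apply (d : G.Dart) : R.faceNext d = R.next d.symm := rfl

theorem faceNext_mk {v w : V} (h : G.Adj v w) :
    R.faceNext ⟨(v, w), h⟩ = ⟨(w, R.rho w v), R.adj_rho h.symm⟩ :=
  R.next_mk h.symm

theorem faceNext_fst (d : G.Dart) : (R.faceNext d).fst = d.snd := R.fst_next _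

/-- A property of neighbors of `v` that is inherited by the following neighbor holds for all of
them as soon as it holds for one. -/
theorem rho_induction [Finite V] {v : V} {C : V → Prop}
    (step : ∀ w, G.Adj v w → C w → C (R.rho v w)) {w w' : V} (h : G.Adj v w) (hw : C w)
    (h' : G.Adj v w') : C w' := by
  have : Finite G.Dart := Finite.of_injective _ SimpleGraph.Dart.toProd_injective
  obtain ⟨k, hk⟩ := (R.sameCycle_next ⟨(v, w), h⟩ ⟨(v, w'), h'⟩ rfl).exists_nat_pow_eq
  have key : ∀ j : ℕ, C ((R.next ^ j) ⟨(v, w), h⟩).snd ∧ ((R.next ^ j) ⟨(v, w), h⟩).fst = v := by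
    intro j
    induction j with
    | zero => exact ⟨hw, rfl⟩
    | succ j ih =>
      rw [pow_succ', Equiv.Perm.mul_apply]
      have h1 := R.next_eq ((R.next ^ j) ⟨(v, w), h⟩)
      have h2 := ((R.next ^ j) ⟨(v, w), h⟩).adj
      rw [h1]
      rw [ih.2] at h2 ⊢
      exact ⟨step _ h2 ih.1, rfl⟩
  have := (key k).1
  rwa [hk] at this

theorem exists_rho_eq [Finite V] {v w : V} (h : G.Adj v w) : ∃ w', G.Adj v w' ∧ R.rho v w' = w := by
  refine ⟨(R.next.symm ⟨(v, w), h⟩).snd, ?_, ?_⟩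
  all_goals
    have h1 := R.next_eq (R.next.symm ⟨(v, w), h⟩)
    rw [Equiv.apply_symm_apply] at h1
    have h2 : (R.next.symm ⟨(v, w), h⟩).fst = v := (congrArg Prod.fst h1).symm
  · have h3 := (R.next.symm ⟨(v, w), h⟩).adj
    rwa [h2] at h3
  · rw [h2] at h1
    exact (congrArg Prod.snd h1).symm

/-- The rotation system with given successor function on the neighbors of every vertex. -/
noncomputable def ofRho [Finite V] (G : SimpleGraph V) (ρ : V → V → V)
    (hadj : ∀ v w, G.Adj v w → G.Adj v (ρ v w))
    (hinj : ∀ v w w', G.Adj v w → G.Adj v w' → ρ v w = ρ v w' → w = w')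
    (hcyc : ∀ v w w', G.Adj v w → G.Adj v w' →
      Relation.ReflTransGen (fun x y => ρ v x = y) w w') : RotationSystem G where
  next := Equiv.ofBijective (fun d => ⟨(d.fst, ρ d.fst d.snd), hadj _ _ d.adj⟩) <| by
    have : Finite G.Dart := Finite.of_injective _ SimpleGraph.Dart.toProd_injective
    refine Finite.injective_iff_bijective.1 ?_
    rintro ⟨⟨v, w⟩, h⟩ ⟨⟨v', w'⟩, h'⟩ e
    simp only [SimpleGraph.Dart.mk.injEq, Prod.mk.injEq] at e
    obtain ⟨rfl, e⟩ := e
    obtain rfl := hinj v w w' h h' e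
    rfl
  fst_next d := rfl
  sameCycle_next := by
    rintro ⟨⟨v, w⟩, h⟩ ⟨⟨v', w'⟩, h'⟩ e
    obtain rfl : v = v' := e
    have h2 : G.Adj v w' := h'
    have h1 : G.Adj v w := h
    induction hcyc v w w' h1 h2 using Relation.ReflTransGen.head_induction_on with
    | refl => exact Equiv.Perm.SameCycle.refl _ _
    | head hab _ ih =>
      subst hab
      exact Equiv.Perm.sameCycle_apply_left.1 (ih (hadj _ _ h1) (hadj _ _ h1))

theorem rho_ofRho [Finite V] (G : SimpleGraph V) (ρ : V → V → V) (hadj hinj hcyc) {v w : V}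
    (h : G.Adj v w) : (ofRho G ρ hadj hinj hcyc).rho v w = ρ v w := by
  have := (ofRho G ρ hadj hinj hcyc).next_mk h
  have h2 : ((ofRho G ρ hadj hinj hcyc).next ⟨(v, w), h⟩).snd = ρ v w := rfl
  rw [this] at h2
  exact h2

end Rho

end RotationSystem

theorem SimpleGraph.Connected.induction_adj {V : Type u} {G : SimpleGraph V} (hc : G.Connected)
    {C : V → Prop} (step : ∀ v w, G.Adj v w → C v → C w) {v : V} (hv : C v) (w : V) : C w := by
  obtain ⟨p⟩ := hc.preconnected v w
  induction p with
  | nil => exact hv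
  | cons h _ ih => exact ih (step _ _ h hv)

namespace RotationSystem

open Module

section Homology

variable {V : Type u} {G : SimpleGraph V}

/-- The antisymmetric functions on darts. -/
def antisymmetric (G : SimpleGraph V) : Submodule ℚ (G.Dart → ℚ) where
  carrier := {φ | ∀ d, φ d.symm = -φ d}
  add_mem' ha hb d := by simp [ha d, hb d, add_comm]
  zero_mem' := by simp
  smul_mem' c φ h d := by simp [h d]

/-- The outflow of a function on darts. -/
def outflow (G : SimpleGraph V) [DecidableEq V] [Fintype G.Dart] :
    (G.Dart → ℚ) →ₗ[ℚ] (V → ℚ) where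
  toFun φ v := ∑ d with d.fst = v, φ d
  map_add' φ ψ := by ext v; simp [Finset.sum_add_distrib]
  map_smul' c φ := by ext v; simp [Finset.mul_sum]

/-- The circulations of a graph: antisymmetric functions on darts without outflow. -/
def circulations (G : SimpleGraph V) [DecidableEq V] [Fintype G.Dart] :
    Submodule ℚ (G.Dart → ℚ) :=
  (LinearMap.ker ((outflow G).domRestrict (antisymmetric G))).map (antisymmetric G).subtype

theorem mem_circulations [DecidableEq V] [Fintype G.Dart] {φ : G.Dart → ℚ} :
    φ ∈ circulations G ↔ (∀ d, φ d.symm = -φ d) ∧ ∀ v, ∑ d with d.fst = v, φ d = 0 := by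
  simp only [circulations, Submodule.mem_map, LinearMap.mem_ker, Submodule.subtype_apply,
    Subtype.exists, LinearMap.domRestrict_apply, exists_and_left, exists_prop]
  constructor
  · rintro ⟨_, h, h2, rfl⟩
    exact ⟨h2, fun v => congrFun h v⟩
  · rintro ⟨h1, h2⟩
    exact ⟨φ, funext h2, h1, rfl⟩

theorem finrank_range_funLeft {X Y : Type*} [Fintype X] [Fintype Y] (π : X → Y)
    (hπ : Function.Surjective π) :
    finrank ℚ (LinearMap.range (LinearMap.funLeft ℚ ℚ π)) = Fintype.card Y := by
  rw [LinearMap.finrank_range_of_inj (LinearMap.funLeft_injective_of_surjective ℚ ℚ π hπ)]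
  simp

theorem finrank_antisymmetric [Finite V] : finrank ℚ (antisymmetric G) = Nat.card G.edgeSet := by
  classical
  have := Fintype.ofFinite V
  set T : (G.Dart → ℚ) →ₗ[ℚ] (G.Dart → ℚ) :=
    LinearMap.id + LinearMap.funLeft ℚ ℚ SimpleGraph.Dart.symm with hT
  have hker : LinearMap.ker T = antisymmetric G := by
    ext φ
    simp only [LinearMap.mem_ker, hT]
    rw [funext_iff]
    refine forall_congr' fun d => ?_
    simp only [LinearMap.add_apply, LinearMap.id_apply, Pi.add_apply, LinearMap.funLeft_apply,
      Pi.zero_apply]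
    constructor <;> intro h <;> linarith
  set π : G.Dart → G.edgeSet := fun d => ⟨d.edge, d.edge_mem⟩ with hπ
  have hsurj : Function.Surjective π := by
    rintro ⟨e, he⟩
    induction e with
    | h a b => exact ⟨⟨(a, b), he⟩, rfl⟩
  have hrange : LinearMap.range T = LinearMap.range (LinearMap.funLeft ℚ ℚ π) := by
    apply le_antisymm
    · rintro _ ⟨φ, rfl⟩
      refine ⟨fun e => T φ (Function.surjInv hsurj e), funext fun d => ?_⟩
      have h1 : π (Function.surjInv hsurj (π d)) = π d := Function.surjInv_eq hsurj _
      have h2 := congrArg Subtype.val h1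
      simp only [hπ] at h2
      rw [LinearMap.funLeft_apply]
      rcases (SimpleGraph.dart_edge_eq_iff _ _).1 h2 with h3 | h3
      · exact congrArg (T φ) h3
      · simp only [hπ, h3]
        simp [hT, LinearMap.funLeft_apply, add_comm]
    · rintro _ ⟨ψ, rfl⟩
      refine ⟨(1 / 2 : ℚ) • LinearMap.funLeft ℚ ℚ π ψ, funext fun d => ?_⟩
      have : π d.symm = π d := Subtype.ext d.edge_symm
      simp only [hT, map_smul, LinearMap.add_apply, LinearMap.id_apply, Pi.add_apply,
        LinearMap.funLeft_apply, Pi.smul_apply, smul_eq_mul, this]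
      ring
  have h1 := LinearMap.finrank_range_add_finrank_ker T
  rw [hker, hrange, finrank_range_funLeft π hsurj] at h1
  have h2 := G.dart_card_eq_twice_card_edges
  rw [finrank_fintype_fun_eq_card, h2] at h1
  rw [Nat.card_eq_fintype_card]
  simp only [SimpleGraph.edgeFinset_card] at h1
  omega

theorem finrank_circulations [Fintype V] [DecidableEq V] [Fintype G.Dart] (hc : G.Connected) :
    finrank ℚ (circulations G) + Nat.card V = Nat.card G.edgeSet + 1 := by
  classical
  set B := (outflow G).domRestrict (antisymmetric G) with hB
  set s : (V → ℚ) →ₗ[ℚ] ℚ := Fintype.linearCombination ℚ (fun _ => (1 : ℚ)) with hs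
  have hsapp : ∀ f, s f = ∑ v, f v := fun f => by simp [hs, Fintype.linearCombination_apply]
  obtain ⟨v₀⟩ := hc.nonempty
  have hsurj : LinearMap.range s = ⊤ := by
    rw [LinearMap.range_eq_top]
    intro q
    exact ⟨Pi.single v₀ q, by rw [hsapp]; simp⟩
  have hsrank := LinearMap.finrank_range_add_finrank_ker s
  rw [hsurj, finrank_top, finrank_self, finrank_fintype_fun_eq_card] at hsrank
  have hrange : LinearMap.range B = LinearMap.ker s := by
    apply le_antisymm
    · rintro _ ⟨⟨φ, hφ⟩, rfl⟩
      rw [LinearMap.mem_ker, hsapp]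
      have h1 : ∑ v, B ⟨φ, hφ⟩ v = ∑ d, φ d :=
        Finset.sum_fiberwise (s := Finset.univ) (g := fun d : G.Dart => d.fst) (f := φ)
      have h2 : ∑ d, φ d = ∑ d : G.Dart, φ d.symm :=
        (Equiv.sum_comp (Function.Involutive.toPerm SimpleGraph.Dart.symm
          SimpleGraph.Dart.symm_involutive) φ).symm
      have h3 : ∑ d : G.Dart, φ d.symm = -∑ d, φ d := by
        rw [← Finset.sum_neg_distrib]
        exact Finset.sum_congr rfl fun d _ => hφ d
      rw [h1]
      linarith
    · have key : ∀ u, (Pi.single u 1 - Pi.single v₀ 1 : V → ℚ) ∈ LinearMap.range B := by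
        refine hc.induction_adj (v := v₀) (fun u w h hu => ?_) (by simp)
        have h1 : (Pi.single w 1 - Pi.single u 1 : V → ℚ) ∈ LinearMap.range B := by
          set d : G.Dart := ⟨(w, u), h.symm⟩ with hd
          refine ⟨⟨Pi.single d 1 - Pi.single d.symm 1, fun e => ?_⟩, ?_⟩
          · simp only [Pi.sub_apply, Pi.single_apply]
            have h2 : e.symm = d ↔ e = d.symm :=
              ⟨fun h => by rw [← h, SimpleGraph.Dart.symm_symm],
                fun h => by rw [h, SimpleGraph.Dart.symm_symm]⟩
            have h3 : e.symm = d.symm ↔ e = d := SimpleGraph.Dart.symm_involutive.injective.eq_iff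
            simp [h2, h3]
          · rw [hB, LinearMap.domRestrict_apply]
            funext v
            change ∑ e : G.Dart with e.fst = v, _ = _
            simp only [Pi.sub_apply, Finset.sum_sub_distrib]
            simp [hd, Pi.single_apply, eq_comm]
        have := Submodule.add_mem _ h1 hu
        simpa using this
      intro f hf
      rw [LinearMap.mem_ker, hsapp] at hf
      have : f = ∑ u, f u • (Pi.single u 1 - Pi.single v₀ 1 : V → ℚ) := by
        funext v
        simp only [smul_sub, Finset.sum_sub_distrib, ← Finset.sum_smul, hf]
        simp [Finset.sum_apply, Pi.single_apply]
      rw [this]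
      exact Submodule.sum_mem _ fun u _ => Submodule.smul_mem _ _ (key u)
  have h1 := LinearMap.finrank_range_add_finrank_ker B
  rw [hrange, finrank_antisymmetric] at h1
  have h2 : finrank ℚ (circulations G) = finrank ℚ (LinearMap.ker B) :=
    Submodule.finrank_map_subtype_eq _ _
  rw [h2, Nat.card_eq_fintype_card (α := V)]
  omega

variable (R : RotationSystem G)

/-- The facial walks of positive length. -/
abbrev FaceCycle : Type u := Quotient (Equiv.Perm.SameCycle.setoid R.faceNext)

/-- The coboundary of a function on the facial walks. -/
def coboundary : (R.FaceCycle → ℚ) →ₗ[ℚ] (G.Dart → ℚ) where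
  toFun p d := p ⟦d⟧ - p ⟦d.symm⟧
  map_add' p q := by ext d; simp; ring
  map_smul' c p := by ext d; simp; ring

theorem mk_faceNext (d : G.Dart) : (⟦R.faceNext d⟧ : R.FaceCycle) = ⟦d⟧ :=
  Quotient.sound (Equiv.Perm.sameCycle_apply_left.2 (Equiv.Perm.SameCycle.refl _ _))

theorem exists_eq_comp_mk {X : Type*} {p : G.Dart → X} (hp : ∀ d, p (R.faceNext d) = p d) :
    ∃ q : R.FaceCycle → X, ∀ d, p d = q ⟦d⟧ := by
  refine ⟨Quotient.lift p ?_, fun d => rfl⟩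
  rintro a b ⟨i, hi⟩
  have key : ∀ (d : G.Dart) (n : ℕ), p ((R.faceNext ^ n) d) = p d := by
    intro d n
    induction n with
    | zero => rfl
    | succ n ih => rw [pow_succ', Equiv.Perm.mul_apply, hp, ih]
  subst hi
  obtain ⟨n, rfl | rfl⟩ := i.eq_nat_or_neg
  · rw [zpow_natCast, key]
  · have := key ((R.faceNext ^ (-(n : ℤ))) a) n
    rw [← this, ← Equiv.Perm.mul_apply, ← zpow_natCast, ← zpow_add]
    simp

theorem sum_sub_symm_eq_zero [DecidableEq V] [Fintype G.Dart] {p : G.Dart → ℚ}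
    (hp : ∀ d, p (R.faceNext d) = p d) (v : V) : ∑ d with d.fst = v, (p d - p d.symm) = 0 := by
  rw [Finset.sum_sub_distrib, sub_eq_zero]
  have : ∑ d : G.Dart with d.fst = v, p d.symm = ∑ d : G.Dart with d.fst = v, p (R.next d) := by
    refine Finset.sum_congr rfl fun d _ => ?_
    rw [← hp d.symm, R.faceNext_apply, SimpleGraph.Dart.symm_symm]
  rw [this]
  symm
  refine Finset.sum_equiv R.next (fun d => ?_) (fun d _ => rfl)
  simp [R.fst_next]

theorem range_coboundary_le [DecidableEq V] [Fintype G.Dart] :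
    LinearMap.range R.coboundary ≤ circulations G := by
  rintro _ ⟨p, rfl⟩
  rw [mem_circulations]
  refine ⟨fun d => by simp [coboundary], fun v => ?_⟩
  exact R.sum_sub_symm_eq_zero (p := fun d => p ⟦d⟧) (fun d => by rw [mk_faceNext]) v

theorem eq_of_invariant [Finite V] (hc : G.Connected) {X : Type*} {p : G.Dart → X}
    (hp : ∀ d, p (R.faceNext d) = p d) (hs : ∀ d, p d.symm = p d) (d e : G.Dart) : p d = p e := by
  have key : ∀ v, ∀ e : G.Dart, e.fst = v → p e = p d := by
    have rot : ∀ (e e' : G.Dart), e.fst = e'.fst → p e = p d → p e' = p d := by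
      rintro ⟨⟨v, w⟩, h⟩ ⟨⟨v', w'⟩, h'⟩ hv hd
      obtain rfl : v = v' := hv
      refine R.rho_induction (v := v) (C := fun w => ∀ h : G.Adj v w, p ⟨(v, w), h⟩ = p d)
        (fun w hw ih _ => ?_) h (fun _ => hd) h' h'
      rw [← R.next_mk hw, ← ih hw, ← hs ⟨(v, w), hw⟩, ← hp (SimpleGraph.Dart.symm _)]
      rfl
    refine hc.induction_adj (fun v w hvw hv e he => ?_) (v := d.fst) (fun e he => rot d e he.symm rfl)
    refine rot ⟨(w, v), hvw.symm⟩ e he.symm ?_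
    rw [← hs]
    exact hv _ rfl
  exact (key _ e rfl).symm

theorem finrank_range_coboundary [Finite V] [Nonempty G.Dart] (hc : G.Connected) :
    finrank ℚ (LinearMap.range R.coboundary) + 1 = Nat.card R.FaceCycle := by
  classical
  have : Finite G.Dart := Finite.of_injective _ SimpleGraph.Dart.toProd_injective
  have := Fintype.ofFinite R.FaceCycle
  have h1 := LinearMap.finrank_range_add_finrank_ker R.coboundary
  rw [finrank_fintype_fun_eq_card] at h1
  have hker : LinearMap.ker R.coboundary = Submodule.span ℚ {fun _ => 1} := by
    ext p
    rw [LinearMap.mem_ker, Submodule.mem_span_singleton]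
    constructor
    · intro hp
      obtain ⟨d₀⟩ := ‹Nonempty G.Dart›
      refine ⟨p ⟦d₀⟧, ?_⟩
      funext q
      induction q using Quotient.inductionOn with
      | h d =>
        have := R.eq_of_invariant hc (p := fun d => p ⟦d⟧) (fun d => by rw [mk_faceNext])
          (fun d => (sub_eq_zero.1 (congrFun hp d)).symm) d₀ d
        simpa using this
    · rintro ⟨c, rfl⟩
      funext d
      simp [coboundary]
  rw [hker, finrank_span_singleton] at h1
  · rw [Nat.card_eq_fintype_card, h1]
  · intro h
    obtain ⟨d₀⟩ := ‹Nonempty G.Dart›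
    simpa using congrFun h ⟦d₀⟧

theorem card_face (h : ∀ v, ∃ w, G.Adj v w) : Nat.card R.Face = Nat.card R.FaceCycle := by
  have : IsEmpty {v : V // ∀ w, ¬ G.Adj v w} := ⟨fun ⟨v, hv⟩ => (h v).elim hv⟩
  exact Nat.card_congr (Equiv.sumEmpty _ _)

theorem isPlane_iff_card [Finite V] [Nontrivial V] (hc : G.Connected) :
    R.IsPlane ↔ Nat.card V + Nat.card R.FaceCycle = Nat.card G.edgeSet + 2 := by
  have h1 : Nat.card G.ConnectedComponent = 1 := by
    have := hc.preconnected.subsingleton_connectedComponent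
    have := hc.nonempty
    have : Nonempty G.ConnectedComponent := this.map G.connectedComponentMk
    exact Nat.card_unique
  rw [IsPlane, card_face _ fun v => hc.preconnected.exists_adj_of_nontrivial v, h1]

theorem isPlane_iff_circulations [Fintype V] [DecidableEq V] [Fintype G.Dart] [Nontrivial V]
    (hc : G.Connected) :
    R.IsPlane ↔ ∀ φ ∈ circulations G, ∃ p : G.Dart → ℚ,
      (∀ d, p (R.faceNext d) = p d) ∧ ∀ d, φ d = p d - p d.symm := by
  have hne : Nonempty G.Dart := by
    obtain ⟨v⟩ := hc.nonempty
    obtain ⟨w, h⟩ := hc.preconnected.exists_adj_of_nontrivial v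
    exact ⟨⟨(v, w), h⟩⟩
  have h1 := finrank_circulations hc
  have h2 := R.finrank_range_coboundary hc
  have h3 : (∀ φ ∈ circulations G, ∃ p : G.Dart → ℚ,
      (∀ d, p (R.faceNext d) = p d) ∧ ∀ d, φ d = p d - p d.symm) ↔
      circulations G ≤ LinearMap.range R.coboundary := by
    refine forall₂_congr fun φ _ => ?_
    constructor
    · rintro ⟨p, hp, hφ⟩
      obtain ⟨q, hq⟩ := R.exists_eq_comp_mk hp
      exact ⟨q, funext fun d => by rw [hφ, hq, hq]; rfl⟩
    · rintro ⟨q, rfl⟩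
      exact ⟨fun d => q ⟦d⟧, fun d => congrArg q (R.mk_faceNext d), fun d => rfl⟩
  rw [h3, R.isPlane_iff_card hc]
  constructor
  · intro h
    refine (Submodule.eq_of_le_of_finrank_eq R.range_coboundary_le ?_).ge
    omega
  · intro h
    have := le_antisymm R.range_coboundary_le h
    rw [this] at h2
    omega

end Homology

end RotationSystem

namespace RotationSystem

section Chord

variable {V : Type u} {G : SimpleGraph V} (R : RotationSystem G)

open Classical in
/-- The successor function after the insertion of the edge `uv`, at `u` in front of the edge to `p`
and at `v` in front of the edge to `q`. -/
noncomputable def chordRho (u v p q s t : V) : V :=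
  if s = u ∧ t = v then p else if s = v ∧ t = u then q
  else if s = u ∧ R.rho s t = p then v else if s = v ∧ R.rho s t = q then u else R.rho s t

variable {R} in
open Classical in
theorem chordRho_of_adj {u v p q s t : V} (h : ¬ G.Adj u v) (hst : G.Adj s t) :
    R.chordRho u v p q s t =
      if s = u ∧ R.rho s t = p then v else if s = v ∧ R.rho s t = q then u else R.rho s t := by
  have h1 : ¬ (s = u ∧ t = v) := by rintro ⟨rfl, rfl⟩; exact h hst
  have h2 : ¬ (s = v ∧ t = u) := by rintro ⟨rfl, rfl⟩; exact h hst.symm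
  simp only [chordRho, if_neg h1, if_neg h2]

theorem sup_edge_adj_iff {u v : V} (h : u ≠ v) {s t : V} :
    (G ⊔ SimpleGraph.edge u v).Adj s t ↔ G.Adj s t ∨ (s = u ∧ t = v) ∨ (s = v ∧ t = u) := by
  rw [SimpleGraph.sup_adj, SimpleGraph.edge_adj]
  constructor
  · rintro (h | ⟨⟨h1, h2⟩ | ⟨h1, h2⟩, _⟩)
    · exact .inl h
    · exact .inr (.inl ⟨h1, h2⟩)
    · exact .inr (.inr ⟨h1, h2⟩)
  · rintro (h' | ⟨rfl, rfl⟩ | ⟨rfl, rfl⟩)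
    · exact .inl h'
    · exact .inr ⟨.inl ⟨rfl, rfl⟩, h⟩
    · exact .inr ⟨.inr ⟨rfl, rfl⟩, h.symm⟩

/-- The rotation system after the insertion of an edge. -/
noncomputable def insertChord [Finite V] {u v p q : V} (hne : u ≠ v) (hna : ¬ G.Adj u v)
    (hp : G.Adj u p) (hq : G.Adj v q) : RotationSystem (G ⊔ SimpleGraph.edge u v) :=
  ofRho _ (R.chordRho u v p q)
    (by
      intro s t h
      rw [sup_edge_adj_iff hne] at h ⊢
      have := fun h => R.adj_rho (v := s) (w := t) h
      unfold chordRho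
      grind)
    (by
      intro s t t' h h'
      rw [sup_edge_adj_iff hne] at h h'
      have h1 := fun h h' => R.rho_inj (v := s) (w := t) (w' := t') h h'
      have h2 := fun h => R.adj_rho (v := s) (w := t) h
      have h3 := fun h => R.adj_rho (v := s) (w := t') h
      have h4 := fun h : G.Adj v u => hna h.symm
      unfold chordRho
      intro heq
      split_ifs at heq <;> grind)
    (by
      intro s w w' h h'
      have step : ∀ t, G.Adj s t → Relation.ReflTransGen
          (fun x y => R.chordRho u v p q s x = y) t (R.rho s t) := by
        intro t ht
        have h1 := chordRho_of_adj (R := R) (p := p) (q := q) hna ht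
        split_ifs at h1 with h2 h3
        · obtain ⟨rfl, rfl⟩ := h2
          refine .head h1 (.single ?_)
          simp [chordRho]
        · obtain ⟨rfl, rfl⟩ := h3
          refine .head h1 (.single ?_)
          simp [chordRho, hne.symm]
        · exact .single h1
      have old : ∀ t t', G.Adj s t → G.Adj s t' → Relation.ReflTransGen
          (fun x y => R.chordRho u v p q s x = y) t t' := by
        intro t t' ht ht'
        exact R.rho_induction (C := fun t' => Relation.ReflTransGen
          (fun x y => R.chordRho u v p q s x = y) t t') (fun w hw ih => ih.trans (step w hw))
          ht .refl ht'
      rw [sup_edge_adj_iff hne] at h h'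
      obtain ⟨tp, htp, rfl⟩ := R.exists_rho_eq hp
      obtain ⟨tq, htq, rfl⟩ := R.exists_rho_eq hq
      have hu : R.chordRho u v (R.rho u tp) (R.rho v tq) u tp = v := by
        rw [chordRho_of_adj hna htp]; simp
      have hv : R.chordRho u v (R.rho u tp) (R.rho v tq) v tq = u := by
        rw [chordRho_of_adj hna htq]; simp [hne.symm]
      have hu' : R.chordRho u v (R.rho u tp) (R.rho v tq) u v = R.rho u tp := by simp [chordRho]
      have hv' : R.chordRho u v (R.rho u tp) (R.rho v tq) v u = R.rho v tq := by
        simp [chordRho, hne.symm]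
      rcases h with h | ⟨rfl, rfl⟩ | ⟨rfl, rfl⟩
      · rcases h' with h' | ⟨rfl, rfl⟩ | ⟨rfl, rfl⟩
        · exact old _ _ h h'
        · exact (old _ _ h htp).tail hu
        · exact (old _ _ h htq).tail hv
      · rcases h' with h' | ⟨-, rfl⟩ | ⟨h', -⟩
        · exact .head hu' (old _ _ hp h')
        · exact .refl
        · exact absurd h' hne
      · rcases h' with h' | ⟨h', -⟩ | ⟨-, rfl⟩
        · exact .head hv' (old _ _ hq h')
        · exact absurd h' hne.symm
        · exact .refl)

theorem insertChord_rho [Finite V] {u v p q : V} (hne : u ≠ v) (hna : ¬ G.Adj u v)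
    (hp : G.Adj u p) (hq : G.Adj v q) {s t : V} (h : (G ⊔ SimpleGraph.edge u v).Adj s t) :
    (R.insertChord hne hna hp hq).rho s t = R.chordRho u v p q s t :=
  rho_ofRho _ _ _ _ _ h

/-- If two vertices occur on the same facial walk, then an edge between them can be inserted. -/
theorem isPlanar_sup_edge [Finite V] [Nontrivial V] (hc : G.Connected) (hR : R.IsPlane)
    {d e : G.Dart} (hde : R.faceNext.SameCycle d e) (hne : d.fst ≠ e.fst)
    (hna : ¬ G.Adj d.fst e.fst) : IsPlanar (G ⊔ SimpleGraph.edge d.fst e.fst) := by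
  classical
  have := Fintype.ofFinite V
  obtain ⟨⟨u, p⟩, hp⟩ := d
  obtain ⟨⟨v, q⟩, hq⟩ := e
  simp only at hne hna
  have hp : G.Adj u p := hp
  have hq : G.Adj v q := hq
  set d : G.Dart := ⟨(u, p), hp⟩ with hd
  set e : G.Dart := ⟨(v, q), hq⟩ with he
  have hde' : d ≠ e := fun h => hne (congrArg (fun d : G.Dart => d.fst) h)
  set G' := G ⊔ SimpleGraph.edge u v with hG'
  have hadj : ∀ s t, G'.Adj s t ↔ G.Adj s t ∨ (s = u ∧ t = v) ∨ (s = v ∧ t = u) :=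
    fun s t => sup_edge_adj_iff hne
  have hle : G ≤ G' := le_sup_left
  have hc' : G'.Connected := hc.mono hle
  set S : RotationSystem G' := R.insertChord hne hna hp hq with hS
  have hSrho : ∀ s t, G'.Adj s t → S.rho s t = R.chordRho u v p q s t :=
    fun s t h => R.insertChord_rho hne hna hp hq h
  refine ⟨S, (S.isPlane_iff_circulations hc').2 fun φ hφ => ?_⟩
  have hFinite : Finite G.Dart := Finite.of_injective _ SimpleGraph.Dart.toProd_injective
  -- the first visit of `e` after `d`
  obtain ⟨m, hm, hmin⟩ : ∃ m : ℕ, (R.faceNext ^ m) d = e ∧ ∀ k < m, (R.faceNext ^ k) d ≠ e :=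
    ⟨Nat.find hde.exists_nat_pow_eq, Nat.find_spec hde.exists_nat_pow_eq,
      fun k hk => Nat.find_min hde.exists_nat_pow_eq hk⟩
  have hm0 : 0 < m := by
    rcases Nat.eq_zero_or_pos m with rfl | h
    · exact absurd hm hde'
    · exact h
  have hpow : ∀ k, (R.faceNext ^ (k + 1)) d = R.faceNext ((R.faceNext ^ k) d) := by
    intro k
    rw [pow_succ', Equiv.Perm.mul_apply]
  have hback : ∀ k < m, (R.faceNext ^ (k + 1)) d ≠ d := by
    intro k hk h
    have h1 : (R.faceNext ^ (m - (k + 1))) ((R.faceNext ^ (k + 1)) d) = e := by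
      rw [← Equiv.Perm.mul_apply, ← pow_add, Nat.sub_add_cancel hk, hm]
    rw [h] at h1
    exact hmin _ (by omega) h1
  set A : G'.Dart → Prop := fun g => g.toProd = (v, u) ∨
    ∃ k < m, ((R.faceNext ^ k) d).toProd = g.toProd with hA
  have hAstep : ∀ g, A g → A (S.faceNext g) := by
    rintro ⟨⟨s, t⟩, hst⟩ hg
    have hst : G'.Adj s t := hst
    rw [S.faceNext_mk hst, hA]
    simp only [hSrho _ _ hst.symm]
    rcases hg with hg | ⟨k, hk, hg⟩
    · obtain ⟨rfl, rfl⟩ := Prod.mk.inj hg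
      exact .inr ⟨0, hm0, by simp [chordRho, hd]⟩
    · have hst' : G.Adj s t := by
        have := ((R.faceNext ^ k) d).adj
        rwa [hg] at this
      have h1 : (R.faceNext ^ k) d = ⟨(s, t), hst'⟩ := SimpleGraph.Dart.ext _ _ hg
      have h2 := hpow k
      rw [h1, R.faceNext_mk hst'] at h2
      rw [chordRho_of_adj hna hst'.symm]
      split_ifs with h3 h4
      · obtain ⟨rfl, h3⟩ := h3
        refine absurd ?_ (hback k hk)
        rw [h2]
        exact SimpleGraph.Dart.ext _ _ (by simp [hd, h3])
      · obtain ⟨rfl, -⟩ := h4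
        exact .inl rfl
      · refine .inr ⟨k + 1, lt_of_le_of_ne hk fun h => h4 ?_, by rw [h2]⟩
        rw [h, hm] at h2
        have := congrArg SimpleGraph.Dart.toProd h2
        obtain ⟨h5, h6⟩ := Prod.mk.inj this
        exact ⟨h5.symm, h6.symm⟩
  have hAinv : ∀ g, A (S.faceNext g) ↔ A g := by
    refine fun g => ⟨fun h => ?_, hAstep g⟩
    simpa using Equiv.Perm.perm_symm_on_of_perm_on_finite (f := S.faceNext) (p := A)
      hAstep h
  set a : G'.Dart → ℚ := fun g => if A g then 1 else 0 with ha
  have hainv : ∀ g, a (S.faceNext g) = a g := fun g => by simp only [ha, hAinv]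
  have huv : G'.Adj u v := (hadj _ _).2 (.inr (.inl ⟨rfl, rfl⟩))
  set x : G'.Dart := ⟨(u, v), huv⟩ with hx
  have hax : a x = 0 := by
    simp only [ha, ite_eq_right_iff, one_ne_zero, imp_false]
    rintro (h | ⟨k, -, h⟩)
    · exact hne (Prod.mk.inj h).1
    · have := ((R.faceNext ^ k) d).adj
      rw [h] at this
      exact hna this
  have hax' : a x.symm = 1 := by
    simp only [ha]
    rw [if_pos]
    exact .inl rfl
  rw [mem_circulations] at hφ
  set ψ : G'.Dart → ℚ := fun g => φ g + φ x * (a g - a g.symm) with hψ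
  have hψx : ψ x = 0 := by simp only [hψ, hax, hax']; ring
  have hψanti : ∀ g, ψ g.symm = -ψ g := by
    intro g
    simp only [hψ, hφ.1 g, SimpleGraph.Dart.symm_symm]
    ring
  have hψnew : ∀ g : G'.Dart, ¬ G.Adj g.fst g.snd → ψ g = 0 := by
    rintro ⟨⟨s, t⟩, hst⟩ h
    have hst' : G'.Adj s t := hst
    rcases (hadj _ _).1 hst' with h' | ⟨rfl, rfl⟩ | ⟨rfl, rfl⟩
    · exact absurd h' h
    · exact hψx
    · have : ψ x.symm = 0 := by rw [hψanti, hψx, neg_zero]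
      exact this
  set j : G.Dart → G'.Dart := fun g => ⟨g.toProd, hle g.adj⟩ with hj
  have hψ0 : (fun g => ψ (j g)) ∈ circulations G := by
    rw [mem_circulations]
    refine ⟨fun g => hψanti (j g), fun w => ?_⟩
    have h1 : ∑ g with g.fst = w, ψ (j g) = ∑ g with g.fst = w, ψ g := by
      refine Finset.sum_of_injOn j ?_ ?_ ?_ (fun _ _ => rfl)
      · intro g _ g' _ h
        exact SimpleGraph.Dart.ext _ _ (congrArg (fun g : G'.Dart => g.toProd) h)
      · intro g hg
        simpa using hg
      · intro g hg hg'
        refine hψnew g fun h => hg' ⟨⟨g.toProd, h⟩, ?_, rfl⟩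
        simpa using hg
    rw [h1]
    simp only [hψ, Finset.sum_add_distrib, ← Finset.mul_sum, hφ.2 w,
      S.sum_sub_symm_eq_zero hainv w]
    ring
  obtain ⟨P, hPinv, hP⟩ := (R.isPlane_iff_circulations hc).1 hR _ hψ0
  have hPe : P e = P d := by
    obtain ⟨c, hc⟩ := R.exists_eq_comp_mk hPinv
    rw [hc, hc]
    exact congrArg c (Quotient.sound hde.symm)
  set Q : G'.Dart → ℚ := fun g => if h : G.Adj g.fst g.snd then P ⟨g.toProd, h⟩ else P d with hQ
  have hQnew : ∀ g : G'.Dart, ¬ G.Adj g.fst g.snd → Q g = P d := fun g h => dif_neg h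
  have hQold : ∀ s t (h : G.Adj s t), Q ⟨(s, t), hle h⟩ = P ⟨(s, t), h⟩ := fun s t h => dif_pos h
  have hQmk : ∀ s t (h : G'.Adj s t) (z : V) (hz : S.rho t s = z),
      S.faceNext ⟨(s, t), h⟩ = ⟨(t, z), hz ▸ S.adj_rho h.symm⟩ := by
    rintro s t h _ rfl
    exact S.faceNext_mk h
  have hQinv : ∀ g, Q (S.faceNext g) = Q g := by
    rintro ⟨⟨s, t⟩, hst⟩
    have hst : G'.Adj s t := hst
    by_cases h : G.Adj s t
    · have h0 := hSrho _ _ hst.symm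
      rw [chordRho_of_adj hna h.symm] at h0
      have h1 := hPinv ⟨(s, t), h⟩
      rw [R.faceNext_mk h] at h1
      rw [hQold s t h, ← h1]
      split_ifs at h0 with h3 h4
      · rw [hQmk s t hst _ h0]
        obtain ⟨rfl, h3⟩ := h3
        rw [hQnew _ hna]
        exact congrArg P (SimpleGraph.Dart.ext _ _ (by simp [hd, h3]))
      · rw [hQmk s t hst _ h0]
        obtain ⟨rfl, h4⟩ := h4
        rw [hQnew _ fun h => hna h.symm, ← hPe]
        exact congrArg P (SimpleGraph.Dart.ext _ _ (by simp [he, h4]))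
      · rw [hQmk s t hst _ h0]
        exact hQold _ _ (R.adj_rho h.symm)
    · rw [hQnew ⟨(s, t), hst⟩ h]
      rcases (hadj _ _).1 hst with h' | ⟨rfl, rfl⟩ | ⟨rfl, rfl⟩
      · exact absurd h' h
      · rw [hQmk _ _ hst q (by rw [hSrho _ _ hst.symm]; simp [chordRho, hne.symm]), hQold _ _ hq,
          hPe]
      · rw [hQmk _ _ hst p (by rw [hSrho _ _ hst.symm]; simp [chordRho]), hQold _ _ hp]
  refine ⟨fun g => Q g - φ x * a g, fun g => by simp only [hQinv, hainv], fun g => ?_⟩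
  have : ψ g = Q g - Q g.symm := by
    obtain ⟨⟨s, t⟩, hst⟩ := g
    by_cases h : G.Adj s t
    · have h1 := hQold s t h
      have h2 := hQold t s h.symm
      have h3 : ψ ⟨(s, t), hst⟩ = P ⟨(s, t), h⟩ - P ⟨(t, s), h.symm⟩ := hP ⟨(s, t), h⟩
      rw [h3, h1]
      exact congrArg _ h2.symm
    · rw [hψnew _ h, hQnew _ h, hQnew, sub_self]
      exact fun h' => h h'.symm
  have h1 : ψ g = φ g + φ x * (a g - a g.symm) := rfl
  simp only
  linarith

end Chord

end RotationSystem

namespace RotationSystem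

section Triangulation

variable {V : Type u} {G : SimpleGraph V} (R : RotationSystem G)

theorem sameCycle_faceNext {u v : V} (h : G.Adj u v) :
    R.faceNext.SameCycle ⟨(u, v), h⟩ ⟨(v, R.rho v u), R.adj_rho h.symm⟩ := by
  rw [← R.faceNext_mk h]
  exact Equiv.Perm.sameCycle_apply_right.2 (Equiv.Perm.SameCycle.refl _ _)

/-- On a maximal planar connected graph, any two vertices on a common facial walk are adjacent. -/
theorem adj_of_sameCycle [Finite V] [Nontrivial V] (hc : G.Connected) (hR : R.IsPlane)
    (hG : IsMaximalPlanar G) {d e : G.Dart} (h : R.faceNext.SameCycle d e) (hne : d.fst ≠ e.fst) :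
    G.Adj d.fst e.fst := by
  by_contra hna
  exact hG.2 _ _ hne hna (R.isPlanar_sup_edge hc hR h hne hna)

theorem eq_of_rho_eq_self [Finite V] {u v w : V} (h : G.Adj v u) (hr : R.rho v u = u)
    (hw : G.Adj v w) : w = u :=
  R.rho_induction (C := fun w => w = u) (fun w _ e => by rw [e, hr]) h rfl hw

/-- If two vertices are the only neighbors of each other, they make up the connected graph. -/
theorem card_le_two_of_rho [Finite V] (hc : G.Connected) {u v : V} (h : G.Adj u v)
    (h1 : R.rho v u = u) (h2 : R.rho u v = v) : Nat.card V ≤ 2 := by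
  have key : ∀ w, w ∈ ({u, v} : Set V) := by
    refine hc.induction_adj (v := u) ?_ (by simp)
    rintro x y hxy (rfl | rfl)
    · exact .inr (R.eq_of_rho_eq_self h h2 hxy)
    · exact .inl (R.eq_of_rho_eq_self h.symm h1 hxy)
  rw [← Set.ncard_univ, ← Set.eq_univ_iff_forall.2 key]
  exact (Set.ncard_insert_le _ _).trans (by simp)

/-- The unit flow along the edge from `x` to `y`. -/
def arcFlow [DecidableEq V] (x y s t : V) : ℚ :=
  (if s = x ∧ t = y then 1 else 0) - (if s = y ∧ t = x then 1 else 0)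

theorem sum_arcFlow [DecidableEq V] [Fintype G.Dart] {x y : V} (h : G.Adj x y) (s : V) :
    ∑ d : G.Dart with d.fst = s, arcFlow x y d.fst d.snd =
      (if s = x then 1 else 0) - (if s = y then 1 else 0) := by
  have aux : ∀ {x y : V} (h : G.Adj x y),
      ∑ d : G.Dart with d.fst = s, (if d.fst = x ∧ d.snd = y then (1 : ℚ) else 0) =
        if s = x then 1 else 0 := by
    intro x y h
    rw [Finset.sum_filter, Finset.sum_eq_single ⟨(x, y), h⟩]
    · simp [eq_comm]
    · rintro ⟨⟨a, b⟩, hab⟩ - hne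
      have : ¬ (a = x ∧ b = y) := by rintro ⟨rfl, rfl⟩; exact hne rfl
      simp [this]
    · simp
  simp only [arcFlow, Finset.sum_sub_distrib, aux h, aux h.symm]

/-- If any two vertices on a common facial walk of a connected plane graph with at least three
vertices are adjacent, then all faces are triangles. -/
theorem rho_rho_of_clique [Finite V] (hn : 3 ≤ Nat.card V) (hc : G.Connected) (hR : R.IsPlane)
    (hcl : ∀ d e : G.Dart, R.faceNext.SameCycle d e → d.fst ≠ e.fst → G.Adj d.fst e.fst)
    {u v : V} (h : G.Adj u v) : R.rho (R.rho v u) v = u := by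
  classical
  have := Fintype.ofFinite V
  have hnt : Nontrivial V := by
    rw [← Finite.one_lt_card_iff_nontrivial]
    omega
  have nondeg : ∀ {u v : V}, G.Adj u v → R.rho v u ≠ u := by
    intro u v h hr
    have h1 : G.Adj u (R.rho u v) := R.adj_rho h
    have h2 : G.Adj (R.rho u v) (R.rho (R.rho u v) u) := R.adj_rho h1.symm
    have h3 : R.faceNext.SameCycle ⟨(v, u), h.symm⟩ ⟨(R.rho u v, R.rho (R.rho u v) u), h2⟩ :=
      (R.sameCycle_faceNext h.symm).trans (R.sameCycle_faceNext h1)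
    by_cases h4 : v = R.rho u v
    · have := R.card_le_two_of_rho hc h hr h4.symm
      omega
    · exact h1.ne (R.eq_of_rho_eq_self h.symm hr (hcl _ _ h3 h4)).symm
  set a := u with ha
  set b := v with hb
  obtain ⟨c, hbc⟩ : ∃ c, R.rho b a = c := ⟨_, rfl⟩
  obtain ⟨e, hce⟩ : ∃ e, R.rho c b = e := ⟨_, rfl⟩
  have hab : G.Adj a b := h
  have hbc' : G.Adj b c := hbc ▸ R.adj_rho hab.symm
  have hce' : G.Adj c e := hce ▸ R.adj_rho hbc'.symm
  have h1 : R.faceNext.SameCycle ⟨(a, b), hab⟩ ⟨(b, c), hbc'⟩ := by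
    subst hbc; exact R.sameCycle_faceNext hab
  have h2 : R.faceNext.SameCycle ⟨(b, c), hbc'⟩ ⟨(c, e), hce'⟩ := by
    subst hce; exact R.sameCycle_faceNext hbc'
  have h3 : R.faceNext.SameCycle ⟨(c, e), hce'⟩ ⟨(e, R.rho e c), R.adj_rho hce'.symm⟩ :=
    R.sameCycle_faceNext hce'
  rw [hbc, hce]
  by_contra hea
  have hac : a ≠ c := fun h => nondeg hab (hbc.trans h.symm)
  have hbe : b ≠ e := fun h => nondeg hbc' (hce.trans h.symm)
  have hca : G.Adj c a := (hcl _ _ (h1.trans h2) hac).symm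
  have hbe' : G.Adj b e := hcl _ _ (h2.trans h3) hbe
  set φ : V → V → ℚ := fun s t => arcFlow a b s t + arcFlow b c s t + arcFlow c a s t with hφ
  have hcirc : (fun d : G.Dart => φ d.fst d.snd) ∈ circulations G := by
    rw [mem_circulations]
    constructor
    · intro d
      simp only [hφ, arcFlow, SimpleGraph.Dart.symm, Prod.fst_swap, Prod.snd_swap, and_comm]
      ring
    · intro s
      simp only [hφ, Finset.sum_add_distrib, sum_arcFlow hab, sum_arcFlow hbc', sum_arcFlow hca]
      ring
  obtain ⟨p, hp, hφp⟩ := (R.isPlane_iff_circulations hc).1 hR _ hcirc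
  set q : V → V → ℚ := fun s t => if h : G.Adj s t then p ⟨(s, t), h⟩ else 0 with hq
  have hqp : ∀ s t (h : G.Adj s t), q s t = p ⟨(s, t), h⟩ := fun s t h => dif_pos h
  have hq1 : ∀ s t, G.Adj s t → q t (R.rho t s) = q s t := by
    intro s t h
    rw [hqp _ _ h, hqp _ _ (R.adj_rho h.symm), ← R.faceNext_mk h, hp]
  have hq2 : ∀ s t, G.Adj s t → φ s t = q s t - q t s := by
    intro s t h
    rw [hqp _ _ h, hqp _ _ h.symm]
    exact hφp ⟨(s, t), h⟩
  have hφbc : φ b c = 1 := by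
    simp only [hφ, arcFlow]
    simp [hab.ne', hbc'.ne, hbc'.ne', hca.ne]
  have hφb : ∀ w, w ≠ a → w ≠ c → φ b w = 0 := by
    intro w hwa hwc
    simp [hφ, arcFlow, hwa, hwc, hab.ne', hbc'.ne]
  have hφe : ∀ w, φ e w = 0 := by
    intro w
    simp [hφ, arcFlow, hea, hbe.symm, hce'.ne']
  have hb1 : ∀ w, G.Adj b w → w = c ∨ q b w = q b c - 1 := by
    intro w hw
    refine R.rho_induction (C := fun w => w = c ∨ q b w = q b c - 1) ?_ hbc' (.inl rfl) hw
    intro w hw ih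
    rcases eq_or_ne w c with rfl | hwc
    · right
      rw [hq1 _ _ hw.symm]
      linarith [hq2 _ _ hw]
    · rcases eq_or_ne w a with rfl | hwa
      · exact .inl hbc
      · right
        rw [hq1 _ _ hw.symm]
        linarith [hq2 _ _ hw, hφb w hwa hwc, ih.resolve_left hwc]
  have hqe : ∀ w, G.Adj e w → q e w = q b c := by
    intro w hw
    refine R.rho_induction (C := fun w => q e w = q b c) ?_ (R.adj_rho hce'.symm) ?_ hw
    · intro w hw ih
      rw [hq1 _ _ hw.symm]
      linarith [hq2 _ _ hw, hφe w]
    · rw [hq1 _ _ hce', ← hq1 _ _ hbc', hce]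
  have h4 := (hb1 e hbe').resolve_left hce'.ne'
  have h5 := hqe b hbe'.symm
  have h6 := hq2 _ _ hbe'
  rw [hφb e hea hce'.ne'] at h6
  linarith

theorem three_mul_card_faceCycle_le [Finite V] (hn : 3 ≤ Nat.card V) (hc : G.Connected) :
    3 * Nat.card R.FaceCycle ≤ 2 * Nat.card G.edgeSet := by
  classical
  have := Fintype.ofFinite V
  have hdart : Nat.card G.Dart = 2 * Nat.card G.edgeSet := by
    rw [Nat.card_eq_fintype_card, G.dart_card_eq_twice_card_edges, Nat.card_eq_fintype_card,
      SimpleGraph.edgeFinset_card]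
  have h1 : ∀ d : G.Dart, R.faceNext d ≠ d := by
    intro d h
    have := congrArg (fun d : G.Dart => d.fst) h
    simp only [R.faceNext_fst] at this
    exact d.snd_ne_fst this
  have h2 : ∀ d : G.Dart, R.faceNext (R.faceNext d) ≠ d := by
    rintro ⟨⟨u, v⟩, h⟩ e
    have h : G.Adj u v := h
    rw [R.faceNext_mk h, R.faceNext_mk] at e
    have e1 := congrArg SimpleGraph.Dart.toProd e
    obtain ⟨e2, e3⟩ := Prod.mk.inj e1
    rw [e2] at e3
    have := R.card_le_two_of_rho hc h e2 e3
    omega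
  rw [← hdart, mul_comm, ← Nat.card_fin 3, ← Nat.card_prod]
  have : Finite R.FaceCycle := Quotient.finite _
  refine Nat.card_le_card_of_injective
    (fun x : R.FaceCycle × Fin 3 => (R.faceNext ^ (x.2 : ℕ)) x.1.out) ?_
  rintro ⟨q, i⟩ ⟨q', j⟩ h
  simp only at h
  have hq : q = q' := by
    have h3 : ∀ (q : R.FaceCycle) (n : ℕ), (⟦(R.faceNext ^ n) q.out⟧ : R.FaceCycle) = q := by
      intro q n
      rw [← Quotient.out_eq q]
      refine Quotient.sound ?_
      rw [Quotient.out_eq q]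
      exact Equiv.Perm.sameCycle_pow_left.2 (Equiv.Perm.SameCycle.refl _ _)
    rw [← h3 q i, h, h3]
  subst hq
  have h5 := R.faceNext.injective.ne (h1 q.out)
  fin_cases i <;> fin_cases j <;> simp [pow_succ] at h ⊢
  · exact h1 _ h.symm
  · exact h2 _ h.symm
  · exact h1 _ h
  · exact h1 _ h.symm
  · exact h2 _ h
  · exact h1 _ h

/-- A connected rotation system all of whose facial walks are triangles, with as many edges as a
triangulation of the sphere. -/
structure IsTriangulation [Finite V] : Prop where
  connected : G.Connected
  rho_rho : ∀ {u v : V}, G.Adj u v → R.rho (R.rho v u) v = u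
  card : 3 * Nat.card V = Nat.card G.edgeSet + 6

variable {R}

theorem faceNext_faceNext_faceNext
    (h : ∀ {u v : V}, G.Adj u v → R.rho (R.rho v u) v = u) (d : G.Dart) :
    R.faceNext (R.faceNext (R.faceNext d)) = d := by
  obtain ⟨⟨u, v⟩, huv⟩ := d
  have huv : G.Adj u v := huv
  have h1 : G.Adj v (R.rho v u) := R.adj_rho huv.symm
  rw [R.faceNext_mk huv, R.faceNext_mk h1, R.faceNext_mk]
  have h2 := h huv
  have h3 := h h1
  rw [h2] at h3
  exact SimpleGraph.Dart.ext _ _ (by simp [h2, h3])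

theorem two_mul_card_edgeSet_le [Finite V]
    (h3 : ∀ d, R.faceNext (R.faceNext (R.faceNext d)) = d) :
    2 * Nat.card G.edgeSet ≤ 3 * Nat.card R.FaceCycle := by
  classical
  have := Fintype.ofFinite V
  have hdart : Nat.card G.Dart = 2 * Nat.card G.edgeSet := by
    rw [Nat.card_eq_fintype_card, G.dart_card_eq_twice_card_edges, Nat.card_eq_fintype_card,
      SimpleGraph.edgeFinset_card]
  rw [← hdart, mul_comm, ← Nat.card_fin 3, ← Nat.card_prod]
  have : Finite R.FaceCycle := Quotient.finite _
  refine Nat.card_le_card_of_surjective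
    (fun x : R.FaceCycle × Fin 3 => (R.faceNext ^ (x.2 : ℕ)) x.1.out) ?_
  intro d
  obtain ⟨n, hn⟩ : ∃ n : ℕ, (R.faceNext ^ n) (⟦d⟧ : R.FaceCycle).out = d :=
    (Quotient.exact (Quotient.out_eq (⟦d⟧ : R.FaceCycle)) :
      R.faceNext.SameCycle _ _).exists_nat_pow_eq
  refine ⟨(⟦d⟧, ⟨n % 3, Nat.mod_lt _ (by norm_num)⟩), ?_⟩
  have h4 : R.faceNext ^ 3 = 1 := by
    ext1 d
    simp [pow_succ, h3]
  simp only
  rw [← pow_eq_pow_mod n h4]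
  exact hn

theorem IsTriangulation.three_le_card [Finite V] (hR : R.IsTriangulation) : 3 ≤ Nat.card V := by
  have h1 := hR.card
  have hnt : Nontrivial V := by
    rw [← Finite.one_lt_card_iff_nontrivial]
    omega
  obtain ⟨v⟩ := hR.connected.nonempty
  obtain ⟨w, h⟩ := hR.connected.preconnected.exists_adj_of_nontrivial v
  have : Nonempty G.edgeSet := ⟨⟨s(v, w), h⟩⟩
  have : 0 < Nat.card G.edgeSet := Nat.card_pos
  omega

theorem IsTriangulation.nontrivial [Finite V] (hR : R.IsTriangulation) : Nontrivial V := by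
  rw [← Finite.one_lt_card_iff_nontrivial]
  have := hR.three_le_card
  omega

theorem IsTriangulation.isPlane [Finite V] (hR : R.IsTriangulation) : R.IsPlane := by
  have := hR.nontrivial
  rw [R.isPlane_iff_card hR.connected]
  have h1 := R.three_mul_card_faceCycle_le hR.three_le_card hR.connected
  have h2 := two_mul_card_edgeSet_le (faceNext_faceNext_faceNext hR.rho_rho)
  have h3 := hR.card
  omega

theorem IsTriangulation.isMaximalPlanar [Finite V] (hR : R.IsTriangulation) :
    IsMaximalPlanar G := by
  refine ⟨⟨R, hR.isPlane⟩, ?_⟩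
  rintro u v hne hna ⟨S, hS⟩
  have := hR.nontrivial
  have hle : G ≤ G ⊔ SimpleGraph.edge u v := le_sup_left
  have hc := hR.connected.mono hle
  rw [S.isPlane_iff_card hc] at hS
  have h1 := S.three_mul_card_faceCycle_le hR.three_le_card hc
  have h2 := hR.card
  have h3 : Nat.card G.edgeSet < Nat.card (G ⊔ SimpleGraph.edge u v).edgeSet := by
    refine Set.ncard_lt_ncard ?_
    rw [SimpleGraph.edgeSet_ssubset_edgeSet]
    refine lt_of_le_of_ne hle fun h => hna ?_
    rw [h]
    exact (sup_edge_adj_iff hne).2 (.inr (.inl ⟨rfl, rfl⟩))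
  omega

end Triangulation

end RotationSystem

/-- A triangulation as a maximal plane graph. -/
def RotationSystem.IsTriangulation.toMaximalPlaneGraph {V : Type u} [Finite V] {G : SimpleGraph V}
    {R : RotationSystem G} (hR : R.IsTriangulation) : MaximalPlaneGraph V :=
  ⟨G, R, hR.isPlane, hR.isMaximalPlanar⟩

namespace MaximalPlaneGraph

variable {V : Type u} [Finite V] (H : MaximalPlaneGraph V)

theorem adj_of_sameCycle [Nontrivial V] (hc : H.graph.Connected) {d e : H.graph.Dart}
    (h : H.rot.faceNext.SameCycle d e) (hne : d.fst ≠ e.fst) : H.graph.Adj d.fst e.fst :=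
  H.rot.adj_of_sameCycle hc H.isPlane H.isMaximalPlanar h hne

theorem isTriangulation (hc : H.graph.Connected) (hn : 3 ≤ Nat.card V) :
    H.rot.IsTriangulation := by
  have hnt : Nontrivial V := by
    rw [← Finite.one_lt_card_iff_nontrivial]
    omega
  have h3 : ∀ {u v : V}, H.graph.Adj u v → H.rot.rho (H.rot.rho v u) v = u := fun h =>
    H.rot.rho_rho_of_clique hn hc H.isPlane (fun _ _ => H.adj_of_sameCycle hc) h
  refine ⟨hc, h3, ?_⟩
  have h1 := H.rot.three_mul_card_faceCycle_le hn hc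
  have h2 := RotationSystem.two_mul_card_edgeSet_le
    (RotationSystem.faceNext_faceNext_faceNext h3)
  have h4 := (H.rot.isPlane_iff_card hc).1 H.isPlane
  omega

end MaximalPlaneGraph

open RotationSystem

section Subgraph

variable {V W : Type u} {H : SimpleGraph V} {G : SimpleGraph W}

theorem SimpleGraph.Copy.mapDart_injective (ι : SimpleGraph.Copy H G) :
    Function.Injective ι.toHom.mapDart := by
  rintro ⟨⟨a, b⟩, h⟩ ⟨⟨a', b'⟩, h'⟩ e
  have e := congrArg SimpleGraph.Dart.toProd e
  obtain ⟨e1, e2⟩ := Prod.mk.inj e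
  obtain rfl := ι.injective e1
  obtain rfl := ι.injective e2
  rfl

theorem SimpleGraph.Copy.mapDart_symm (ι : SimpleGraph.Copy H G) (d : H.Dart) :
    ι.toHom.mapDart d.symm = (ι.toHom.mapDart d).symm := rfl

theorem SimpleGraph.Copy.symm_mem_range_mapDart (ι : SimpleGraph.Copy H G) {g : G.Dart}
    (h : g.symm ∈ Set.range ι.toHom.mapDart) : g ∈ Set.range ι.toHom.mapDart := by
  obtain ⟨d, hd⟩ := h
  exact ⟨d.symm, by rw [ι.mapDart_symm, hd, SimpleGraph.Dart.symm_symm]⟩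

theorem SimpleGraph.Copy.dist_le (ι : SimpleGraph.Copy H G) (hc : H.Connected) (u v : V) :
    G.dist (ι u) (ι v) ≤ H.dist u v := by
  obtain ⟨p, hp⟩ := hc.exists_walk_length_eq_dist u v
  rw [← hp, ← SimpleGraph.Walk.length_map ι.toHom p]
  exact SimpleGraph.dist_le _

/-- The faces of a plane graph lie in the faces of its plane subgraphs: there is a labelling of the
facial walks of the graph by those of the subgraph, encoded by rational numbers, that only changes
across the edges of the subgraph. -/
theorem IsEmbeddedSubgraph.exists_face_label [Finite V] [Finite W] [Nontrivial V] [Nontrivial W]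
    {R : RotationSystem H} {S : RotationSystem G} {ι : SimpleGraph.Copy H G}
    (hι : IsEmbeddedSubgraph R S ι) (hH : H.Connected) (hG : G.Connected) (hS : S.IsPlane) :
    ∃ (c : R.FaceCycle → ℚ) (P : G.Dart → ℚ), Function.Injective c ∧
      (∀ g, P (S.faceNext g) = P g) ∧ (∀ g ∉ Set.range ι.toHom.mapDart, P g.symm = P g) ∧
      ∀ d, P (ι.toHom.mapDart d) = c ⟦d⟧ := by
  classical
  have := Fintype.ofFinite V
  have := Fintype.ofFinite W
  have hFinite : Finite R.FaceCycle := Quotient.finite _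
  obtain ⟨c, hcinj⟩ : ∃ c : R.FaceCycle → ℚ, Function.Injective c :=
    ⟨fun q => ((Finite.equivFin R.FaceCycle q : ℕ) : ℚ), fun q q' h => by
      simpa [Fin.val_inj] using h⟩
  set j := ι.toHom.mapDart with hj
  have hjinj : Function.Injective j := ι.mapDart_injective
  set ψ : H.Dart → ℚ := fun d => c ⟦d⟧ - c ⟦d.symm⟧ with hψ
  set φ : G.Dart → ℚ := Function.extend j ψ 0 with hφ
  have hφj : ∀ d, φ (j d) = ψ d := fun d => hjinj.extend_apply _ _ _
  have hφ0 : ∀ g ∉ Set.range j, φ g = 0 := fun g hg => Function.extend_apply' _ _ _ hg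
  have hcirc : φ ∈ circulations G := by
    rw [mem_circulations]
    constructor
    · intro g
      by_cases hg : g ∈ Set.range j
      · obtain ⟨d, rfl⟩ := hg
        rw [← ι.mapDart_symm, hφj, hφj]
        simp [hψ]
      · rw [hφ0 _ hg, hφ0 _ fun h => hg (ι.symm_mem_range_mapDart h), neg_zero]
    · intro z
      by_cases hz : ∃ w, ι w = z
      · obtain ⟨w, rfl⟩ := hz
        rw [← R.sum_sub_symm_eq_zero (p := fun d => c ⟦d⟧) (fun d => congrArg c (R.mk_faceNext d)) w]
        symm
        refine Finset.sum_of_injOn j hjinj.injOn ?_ ?_ ?_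
        · intro d hd
          simp only [Finset.coe_filter, Finset.mem_univ, true_and, Set.mem_ofPred_eq] at hd ⊢
          rw [← hd]
          rfl
        · intro g hg hg'
          refine hφ0 _ ?_
          rintro ⟨d, rfl⟩
          refine hg' ⟨d, ?_, rfl⟩
          simp only [Finset.coe_filter, Finset.mem_filter, Finset.mem_univ, true_and,
            Set.mem_ofPred_eq] at hg ⊢
          exact ι.injective hg
        · intro d _
          exact (hφj d).symm
      · refine Finset.sum_eq_zero fun g hg => hφ0 _ ?_
        rintro ⟨d, rfl⟩
        simp only [Finset.mem_filter, Finset.mem_univ, true_and] at hg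
        exact hz ⟨d.fst, hg⟩
  obtain ⟨P, hP, hPφ⟩ := (S.isPlane_iff_circulations hG).1 hS φ hcirc
  have hnext : ∀ g, P (S.next g) = P g.symm := by
    intro g
    rw [← hP g.symm, S.faceNext_apply, SimpleGraph.Dart.symm_symm]
  have hout : ∀ g ∉ Set.range j, P g.symm = P g := by
    intro g hg
    linarith [hPφ g, hφ0 g hg]
  have hinv : ∀ d : H.Dart, P (j (R.faceNext d)) - c ⟦R.faceNext d⟧ = P (j d) - c ⟦d⟧ := by
    intro d
    rw [R.mk_faceNext]
    obtain ⟨k, hk, hk1, hk2⟩ := hι d.symm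
    rw [← hj] at hk1 hk2
    rw [R.faceNext_apply, ← hk1]
    have key : ∀ i, i < k → P ((S.next ^ (i + 1)) (j d.symm)) = P (j d) := by
      intro i
      induction i with
      | zero =>
        intro _
        rw [zero_add, pow_one, hnext]
        rfl
      | succ i ih =>
        intro hi
        rw [pow_succ', Equiv.Perm.mul_apply, hnext, hout _ (hk2 _ (by omega) hi), ih (by omega)]
    have := key (k - 1) (by omega)
    rw [Nat.sub_add_cancel hk] at this
    rw [this]
  have hsymm : ∀ d : H.Dart, P (j d.symm) - c ⟦d.symm⟧ = P (j d) - c ⟦d⟧ := by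
    intro d
    have h1 := hPφ (j d)
    rw [hφj, ← ι.mapDart_symm, ← hj] at h1
    simp only [hψ] at h1
    linarith
  obtain ⟨v⟩ := hH.nonempty
  obtain ⟨w, hvw⟩ := hH.preconnected.exists_adj_of_nontrivial v
  set d₀ : H.Dart := ⟨(v, w), hvw⟩
  refine ⟨c, fun g => P g - (P (j d₀) - c ⟦d₀⟧), hcinj, fun g => by simp only [hP],
    fun g hg => by simp only [hout g hg], fun d => ?_⟩
  have h1 : P (j d) - c ⟦d⟧ = P (j d₀) - c ⟦d₀⟧ :=
    R.eq_of_invariant hH (p := fun d => P (j d) - c ⟦d⟧) hinv hsymm d d₀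
  linarith

theorem exists_dart_of_face_label [Finite V] [Finite W] [Nontrivial V] {S : RotationSystem G}
    {ι : SimpleGraph.Copy H G} (hH : H.Connected) {P : G.Dart → ℚ}
    (hP : ∀ g, P (S.faceNext g) = P g)
    (hout : ∀ g ∉ Set.range ι.toHom.mapDart, P g.symm = P g) {w : V} {g : G.Dart}
    (hg : g.fst = ι w) : ∃ e : H.Dart, e.fst = w ∧ P (ι.toHom.mapDart e) = P g := by
  by_contra! hcon
  obtain ⟨⟨z, t⟩, h⟩ := g
  obtain rfl : z = ι w := hg
  have h : G.Adj (ι w) t := h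
  obtain ⟨w', hw'⟩ := hH.preconnected.exists_adj_of_nontrivial w
  have h' : G.Adj (ι w) (ι w') := ι.toHom.map_adj hw'
  refine hcon ⟨(w, w'), hw'⟩ rfl ?_
  refine S.rho_induction (v := ι w)
    (C := fun s => ∀ hs : G.Adj (ι w) s, P ⟨(ι w, s), hs⟩ = P ⟨(ι w, t), h⟩)
    (fun s hs ih hs' => ?_) h (fun _ => rfl) h' h'
  rw [← ih hs, ← hout ⟨(ι w, s), hs⟩, ← hP (SimpleGraph.Dart.symm _), S.faceNext_apply,
    SimpleGraph.Dart.symm_symm, S.next_mk]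
  rintro ⟨e, he⟩
  refine hcon e (ι.injective (congrArg (fun d : G.Dart => d.fst) he)) ?_
  rw [he, ih]

theorem face_label_eq_of_notMem_range [Finite W] {S : RotationSystem G}
    {ι : SimpleGraph.Copy H G} {P : G.Dart → ℚ} (hP : ∀ g, P (S.faceNext g) = P g)
    (hout : ∀ g ∉ Set.range ι.toHom.mapDart, P g.symm = P g) {g g' : G.Dart}
    (hg : ∀ w, ι w ≠ g.fst) (hgg' : g.fst = g'.fst) : P g' = P g := by
  obtain ⟨⟨z, t⟩, h⟩ := g
  obtain ⟨⟨z', t'⟩, h'⟩ := g'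
  obtain rfl : z = z' := hgg'
  refine S.rho_induction (v := z)
    (C := fun s => ∀ hs : G.Adj z s, P ⟨(z, s), hs⟩ = P ⟨(z, t), h⟩)
    (fun s hs ih hs' => ?_) h (fun _ => rfl) h' h'
  rw [← ih hs, ← hout ⟨(z, s), hs⟩, ← hP (SimpleGraph.Dart.symm _), S.faceNext_apply,
    SimpleGraph.Dart.symm_symm, S.next_mk]
  rintro ⟨e, he⟩
  exact hg e.fst (congrArg (fun d : G.Dart => d.fst) he)

/-- Every path from a vertex `v` of a maximal plane graph to a vertex `x` in one of its faces meets
the boundary of that face, where the distance from `v` is measured in the maximal plane graph. -/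
theorem exists_dist_add_dist_le [Finite V] [Finite W] [Nontrivial V] {R : RotationSystem H}
    {S : RotationSystem G} {ι : SimpleGraph.Copy H G} (hH : H.Connected) (hG : G.Connected)
    (hcl : ∀ d e : H.Dart, R.faceNext.SameCycle d e → d.fst ≠ e.fst → H.Adj d.fst e.fst)
    {c : R.FaceCycle → ℚ} {P : G.Dart → ℚ} (hc : Function.Injective c)
    (hP : ∀ g, P (S.faceNext g) = P g)
    (hout : ∀ g ∉ Set.range ι.toHom.mapDart, P g.symm = P g)
    (hPc : ∀ d, P (ι.toHom.mapDart d) = c ⟦d⟧) (v : V) {x : W} (hx : ∀ w, ι w ≠ x) :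
    ∃ e : H.Dart, (∀ g : G.Dart, g.fst = x → P g = c ⟦e⟧) ∧
      H.dist v e.fst + G.dist (ι e.fst) x ≤ G.dist (ι v) x := by
  set Good : W → ℕ → Prop := fun z n => (∀ w, ι w = z → H.dist v w ≤ n) ∧
    ((∀ w, ι w ≠ z) → ∃ e : H.Dart, (∀ g : G.Dart, g.fst = z → P g = c ⟦e⟧) ∧
      H.dist v e.fst + G.dist (ι e.fst) z ≤ n) with hGood
  have hadj : ∀ {w w' : V}, H.Adj w w' → H.dist v w' ≤ H.dist v w + 1 := by
    intro w w' h
    have h1 := hH.dist_triangle (u := v) (v := w) (w := w')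
    rwa [SimpleGraph.dist_eq_one_iff_adj.2 h] at h1
  have hface : ∀ {e e' : H.Dart}, c ⟦e⟧ = c ⟦e'⟧ → H.dist v e'.fst ≤ H.dist v e.fst + 1 := by
    intro e e' h
    by_cases hne : e.fst = e'.fst
    · rw [hne]; omega
    · exact hadj (hcl _ _ (Quotient.exact (hc h)) hne)
  have step : ∀ {y z : W} {n : ℕ}, G.Adj y z → Good y n → Good z (n + 1) := by
    intro y z n hyz hy
    set g : G.Dart := ⟨(y, z), hyz⟩ with hg
    by_cases hyr : ∃ w, ι w = y
    · obtain ⟨w, rfl⟩ := hyr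
      have hw := hy.1 w rfl
      obtain ⟨e, he, hPe⟩ := exists_dart_of_face_label (ι := ι) hH hP hout (w := w) (g := g) rfl
      refine ⟨fun w' hw' => ?_, fun hz => ⟨e, fun g' hg' => ?_, ?_⟩⟩
      · subst hw'
        by_cases hr : g ∈ Set.range ι.toHom.mapDart
        · obtain ⟨d, hd⟩ := hr
          have h1 := congrArg SimpleGraph.Dart.toProd hd
          obtain ⟨h2, h3⟩ := Prod.mk.inj h1
          have h2 := ι.injective h2
          have h3 := ι.injective h3
          have h4 := d.adj
          rw [h2, h3] at h4
          exact (hadj h4).trans (by omega)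
        · obtain ⟨e', he', hPe'⟩ :=
            exists_dart_of_face_label (ι := ι) hH hP hout (w := w') (g := g.symm) rfl
          have h1 : c ⟦e⟧ = c ⟦e'⟧ := by rw [← hPc, ← hPc, hPe, hPe', hout g hr]
          have h2 := hface h1
          rw [he, he'] at h2
          omega
      · have hr : g ∉ Set.range ι.toHom.mapDart := by
          rintro ⟨d, hd⟩
          exact hz d.snd (congrArg (fun d : G.Dart => d.snd) hd)
        rw [face_label_eq_of_notMem_range (ι := ι) hP hout (g := g.symm) hz hg'.symm, hout g hr,
          ← hPe, hPc]
      · rw [he, SimpleGraph.dist_eq_one_iff_adj.2 hyz]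
        omega
    · push Not at hyr
      obtain ⟨e, hPe, hd⟩ := hy.2 hyr
      have hr : g ∉ Set.range ι.toHom.mapDart := by
        rintro ⟨d, hd⟩
        exact hyr d.fst (congrArg (fun d : G.Dart => d.fst) hd)
      refine ⟨fun w' hw' => ?_, fun hz => ⟨e, fun g' hg' => ?_, ?_⟩⟩
      · obtain ⟨e', he', hPe'⟩ :=
          exists_dart_of_face_label (ι := ι) hH hP hout (w := w') (g := g.symm) hw'.symm
        have h1 : c ⟦e⟧ = c ⟦e'⟧ := by rw [← hPe g rfl, ← hPc, hPe', hout g hr]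
        have h2 := hface h1
        rw [he'] at h2
        omega
      · rw [face_label_eq_of_notMem_range (ι := ι) hP hout (g := g.symm) hz hg'.symm, hout g hr]
        exact hPe g rfl
      · have h1 := hG.dist_triangle (u := ι e.fst) (v := y) (w := z)
        rw [SimpleGraph.dist_eq_one_iff_adj.2 hyz] at h1
        omega
  have walk : ∀ {y z : W} (p : G.Walk y z) (n : ℕ), Good y n → Good z (n + p.length) := by
    intro y z p
    induction p with
    | nil => exact fun n h => h
    | cons h p ih =>
      intro n hy
      have := ih (n + 1) (step h hy)
      rwa [SimpleGraph.Walk.length_cons, add_comm p.length, ← add_assoc]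
  obtain ⟨p, hp⟩ := hG.exists_walk_length_eq_dist (ι v) x
  have h0 : Good (ι v) 0 := by
    refine ⟨fun w hw => ?_, fun h => absurd rfl (h v)⟩
    rw [ι.injective hw, SimpleGraph.dist_self]
  have := (walk p 0 h0).2 hx
  rwa [zero_add, hp] at this

end Subgraph

theorem MaximalPlaneGraph.exists_quasiEccentric {V W : Type u} [Finite V] [Finite W]
    (H : MaximalPlaneGraph V) (hH : H.graph.Connected) {G : MaximalPlaneGraph W}
    {ι : SimpleGraph.Copy H.graph G.graph} (hι : IsEmbeddedSubgraph H.rot G.rot ι) {α : ℕ}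
    (hα : ∀ v, G.graph.eccent (ι v) = α) (u : V) (hu : H.graph.eccent u < α) :
    ∃ f : H.rot.Face, u ∈ quasiEccentric H.graph (H.rot.boundary f) := by
  rcases subsingleton_or_nontrivial V with hV | hV
  · refine ⟨.inr ⟨u, fun w h => h.ne (Subsingleton.elim _ _)⟩, fun v => ⟨u, rfl, ?_⟩⟩
    rw [Subsingleton.elim v u]
  have hW : Nontrivial W := ι.injective.nontrivial
  have hG : G.graph.Connected := by
    by_contra h
    have h1 := SimpleGraph.eccent_eq_top_of_not_connected h (ι u)
    rw [hα] at h1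
    exact ENat.natCast_ne_top α h1
  have hdist : ∀ v x, G.graph.dist (ι v) x ≤ α := by
    intro v x
    have h1 : G.graph.edist (ι v) x ≤ G.graph.eccent (ι v) := SimpleGraph.edist_le_eccent
    rw [hα, ← (hG.preconnected _ _).coe_dist_eq_edist] at h1
    exact_mod_cast h1
  obtain ⟨x, hx⟩ := G.graph.exists_edist_eq_eccent_of_finite (ι u)
  rw [hα, ← (hG.preconnected _ _).coe_dist_eq_edist, Nat.cast_inj] at hx
  have hxι : ∀ w, ι w ≠ x := by
    rintro w rfl
    have h1 : H.graph.edist u w < α := SimpleGraph.edist_le_eccent.trans_lt hu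
    rw [← (hH.preconnected _ _).coe_dist_eq_edist, Nat.cast_lt] at h1
    have := ι.dist_le hH u w
    omega
  obtain ⟨c, P, hc, hP, hout, hPc⟩ := hι.exists_face_label hH hG G.isPlane
  have key := fun v => exists_dist_add_dist_le hH hG (fun _ _ => H.adj_of_sameCycle hH) hc hP hout
    hPc v hxι
  obtain ⟨e₀, he₀, -⟩ := key u
  obtain ⟨t, ht⟩ := hG.preconnected.exists_adj_of_nontrivial x
  refine ⟨.inl ⟦e₀⟧, fun v => ?_⟩
  obtain ⟨e, he, hd⟩ := key v
  refine ⟨e.fst, ⟨e, hc ?_, rfl⟩, ?_⟩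
  · rw [← he ⟨(x, t), ht⟩ rfl, ← he₀ ⟨(x, t), ht⟩ rfl]
  · rw [← (hH.preconnected _ _).coe_dist_eq_edist, ← (hH.preconnected _ _).coe_dist_eq_edist,
      Nat.cast_le]
    have h1 := hG.dist_triangle (u := ι u) (v := ι e.fst) (w := x)
    have h2 := ι.dist_le hH u e.fst
    have h3 := hdist v x
    omega

/-- The graph with a new vertex `none` that is adjacent to three given vertices. -/
def SimpleGraph.insertVertex {W : Type u} (G : SimpleGraph W) (a b c : W) :
    SimpleGraph (Option W) where
  Adj
    | none, none => False
    | none, some w => w = a ∨ w = b ∨ w = c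
    | some w, none => w = a ∨ w = b ∨ w = c
    | some v, some w => G.Adj v w
  symm := ⟨by
    rintro (_ | v) (_ | w) h
    · exact h
    · exact h
    · exact h
    · exact SimpleGraph.Adj.symm (G := G) h⟩
  loopless := ⟨by
    rintro (_ | v) h
    · exact h
    · exact G.irrefl h⟩

namespace SimpleGraph

variable {W : Type u} {G : SimpleGraph W} {a b c : W}

@[simp] theorem insertVertex_none_none : ¬ (G.insertVertex a b c).Adj none none := id

@[simp] theorem insertVertex_none_some {w : W} :
    (G.insertVertex a b c).Adj none (some w) ↔ w = a ∨ w = b ∨ w = c := Iff.rfl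

@[simp] theorem insertVertex_some_none {w : W} :
    (G.insertVertex a b c).Adj (some w) none ↔ w = a ∨ w = b ∨ w = c := Iff.rfl

@[simp] theorem insertVertex_some_some {v w : W} :
    (G.insertVertex a b c).Adj (some v) (some w) ↔ G.Adj v w := Iff.rfl

/-- The copy of a graph in the graph with an additional vertex. -/
def copyInsertVertex (G : SimpleGraph W) (a b c : W) : Copy G (G.insertVertex a b c) :=
  ⟨⟨some, fun h => h⟩, Option.some_injective W⟩

theorem Connected.insertVertex (hc : G.Connected) : (G.insertVertex a b c).Connected := by
  rw [connected_iff_exists_forall_reachable]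
  refine ⟨some a, fun x => ?_⟩
  rcases x with _ | v
  · exact Adj.reachable (G := G.insertVertex a b c) (u := some a) (v := none) (.inl rfl)
  · exact (hc.preconnected a v).map (G.copyInsertVertex a b c).toHom

theorem card_edgeSet_insertVertex [Finite W] (hab : a ≠ b) (hbc : b ≠ c) (hca : c ≠ a) :
    Nat.card (G.insertVertex a b c).edgeSet = Nat.card G.edgeSet + 3 := by
  have h1 : (G.insertVertex a b c).edgeSet =
      Sym2.map some '' G.edgeSet ∪ {s(none, some a), s(none, some b), s(none, some c)} := by
    ext e
    induction e with
    | h x y =>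
      simp only [mem_edgeSet, Set.mem_union, Set.mem_image, Sym2.exists, Sym2.map_mk,
        Set.mem_insert_iff, Set.mem_singleton_iff]
      rcases x with _ | x <;> rcases y with _ | y
      · simp
      · simp
      · simp
      · simp only [insertVertex_some_some, Sym2.eq_iff, Option.some.injEq, reduceCtorEq, false_and,
          and_false, or_self, or_false]
        constructor
        · exact fun h => ⟨x, y, h, .inl ⟨rfl, rfl⟩⟩
        · rintro ⟨x', y', h, ⟨rfl, rfl⟩ | ⟨rfl, rfl⟩⟩
          · exact h
          · exact h.symm
  change (G.insertVertex a b c).edgeSet.ncard = G.edgeSet.ncard + 3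
  have h2 : ({s(none, some a), s(none, some b), s(none, some c)} : Set (Sym2 (Option W))).ncard
      = 3 :=
    Set.ncard_eq_three.2
      ⟨_, _, _, by simpa using hab, by simpa using hca.symm, by simpa using hbc, rfl⟩
  rw [h1, Set.ncard_union_eq, Set.ncard_image_of_injective _
    (Sym2.map.injective (Option.some_injective W)), h2]
  rw [Set.disjoint_left]
  rintro _ ⟨e, -, rfl⟩
  induction e with
  | h x y => simp

end SimpleGraph

namespace RotationSystem

variable {W : Type u} {G : SimpleGraph W} (R : RotationSystem G)

/-- The three vertices on a triangular face, in the order of face tracing. -/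
structure IsTriangle (a b c : W) : Prop where
  adj_ab : G.Adj a b
  adj_bc : G.Adj b c
  adj_ca : G.Adj c a
  rho_b : R.rho b a = c
  rho_c : R.rho c b = a
  rho_a : R.rho a c = b

variable {R} in
theorem IsTriangle.rotate {a b c : W} (h : R.IsTriangle a b c) : R.IsTriangle b c a :=
  ⟨h.adj_bc, h.adj_ca, h.adj_ab, h.rho_c, h.rho_a, h.rho_b⟩

variable {R} in
theorem IsTriangulation.isTriangle [Finite W] (hR : R.IsTriangulation) {a b : W}
    (h : G.Adj a b) : R.IsTriangle a b (R.rho b a) := by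
  have h1 : G.Adj b (R.rho b a) := R.adj_rho h.symm
  have h2 := hR.rho_rho h
  have h3 := hR.rho_rho h1
  have h4 : G.Adj (R.rho b a) (R.rho (R.rho b a) b) := R.adj_rho h1.symm
  rw [h2] at h3 h4
  exact ⟨h, h1, h4, rfl, h2, h3⟩

variable {R} in
theorem IsTriangulation.isTriangle_of_rho [Finite W] (hR : R.IsTriangulation) {a b c : W}
    (h : G.Adj a b) (hc : R.rho b a = c) : R.IsTriangle a b c :=
  hc ▸ hR.isTriangle h

open Classical in
/-- The successor function after the insertion of a vertex in the triangular face `abc`. -/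
noncomputable def insertRho (a b c : W) : Option W → Option W → Option W
  | none, none => none
  | none, some w => if w = b then some a else if w = c then some b else some c
  | some v, none => if v = b then some c else if v = c then some a else some b
  | some v, some w => if (v = b ∧ w = a) ∨ (v = c ∧ w = b) ∨ (v = a ∧ w = c) then none
      else some (R.rho v w)

variable {R} in
theorem IsTriangle.insertRho_adj {a b c : W} (hT : R.IsTriangle a b c) (v w : Option W)
    (h : (G.insertVertex a b c).Adj v w) :
    (G.insertVertex a b c).Adj v (R.insertRho a b c v w) := by
  obtain ⟨hab, hbc, hca, hb, hc, ha⟩ := hT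
  rcases v with _ | v <;> rcases w with _ | w
  · exact h
  · simp only [insertRho]
    split_ifs <;> simp
  · simp only [SimpleGraph.insertVertex_some_none] at h
    simp only [insertRho]
    split_ifs with h1 h2
    · subst h1; exact hbc
    · subst h2; exact hca
    · obtain rfl : v = a := by tauto
      exact hab
  · simp only [insertRho]
    split_ifs with h1
    · simp only [SimpleGraph.insertVertex_some_none]
      tauto
    · exact R.adj_rho h

variable {R} in
theorem IsTriangle.insertRho_inj {a b c : W} (hT : R.IsTriangle a b c) (v w w' : Option W)
    (h : (G.insertVertex a b c).Adj v w) (h' : (G.insertVertex a b c).Adj v w')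
    (e : R.insertRho a b c v w = R.insertRho a b c v w') : w = w' := by
  have hab := hT.adj_ab.ne
  have hbc := hT.adj_bc.ne
  have hca := hT.adj_ca.ne
  rcases v with _ | v
  · rcases w with _ | w <;> rcases w' with _ | w'
    · rfl
    · exact absurd h id
    · exact absurd h' id
    · simp only [insertRho] at e
      simp only [SimpleGraph.insertVertex_none_some] at h h'
      split_ifs at e <;> grind
  · have h1 := fun {w w' : W} => R.rho_inj (v := v) (w := w) (w' := w')
    have h2 := hT.rho_a
    have h3 := hT.rho_b
    have h4 := hT.rho_c
    have h5 := hT.adj_ab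
    have h6 := hT.adj_bc
    have h7 := hT.adj_ca
    have h8 := hT.adj_ab.symm
    have h9 := hT.adj_bc.symm
    have h10 := hT.adj_ca.symm
    rcases w with _ | w <;> rcases w' with _ | w'
    · rfl
    · simp only [insertRho] at e
      simp only [SimpleGraph.insertVertex_some_none, SimpleGraph.insertVertex_some_some] at h h'
      have h11 := fun w => h1 (w := w') (w' := w) h'
      split_ifs at e <;> grind
    · simp only [insertRho] at e
      simp only [SimpleGraph.insertVertex_some_none, SimpleGraph.insertVertex_some_some] at h h'
      have h11 := fun w' => h1 (w := w) (w' := w') h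
      split_ifs at e <;> grind
    · simp only [insertRho] at e
      simp only [SimpleGraph.insertVertex_some_some] at h h'
      have h11 := h1 h h'
      split_ifs at e <;> grind

variable {R} in
theorem IsTriangle.insertRho_reaches [Finite W] {a b c : W} (hT : R.IsTriangle a b c)
    (v w w' : Option W) (h : (G.insertVertex a b c).Adj v w)
    (h' : (G.insertVertex a b c).Adj v w') :
    Relation.ReflTransGen (fun x y => R.insertRho a b c v x = y) w w' := by
  have hab := hT.adj_ab.ne
  have hbc := hT.adj_bc.ne
  have hca := hT.adj_ca.ne
  rcases v with _ | v
  · set r : Option W → Option W → Prop := fun x y => R.insertRho a b c none x = y with hr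
    have h1 : Relation.ReflTransGen r (some b) (some a) := .single (by simp [hr, insertRho])
    have h2 : Relation.ReflTransGen r (some c) (some b) :=
      .single (by simp [hr, insertRho, hbc.symm])
    have h3 : Relation.ReflTransGen r (some a) (some c) :=
      .single (by simp [hr, insertRho, hab, hca.symm])
    rcases w with _ | w
    · exact absurd h id
    rcases w' with _ | w'
    · exact absurd h' id
    rw [SimpleGraph.insertVertex_none_some] at h h'
    rcases h with rfl | rfl | rfl <;> rcases h' with rfl | rfl | rfl
    · exact .refl
    · exact h3.trans h2
    · exact h3
    · exact h1
    · exact .refl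
    · exact h1.trans h3
    · exact h2.trans h1
    · exact h2
    · exact .refl
  · set r : Option W → Option W → Prop := fun x y => R.insertRho a b c (some v) x = y with hr
    have step : ∀ t, G.Adj v t → Relation.ReflTransGen r (some t) (some (R.rho v t)) := by
      intro t ht
      by_cases h1 : (v = b ∧ t = a) ∨ (v = c ∧ t = b) ∨ (v = a ∧ t = c)
      · refine .head (b := none) (by simp only [hr, insertRho, if_pos h1]) (.single ?_)
        rcases h1 with ⟨rfl, rfl⟩ | ⟨rfl, rfl⟩ | ⟨rfl, rfl⟩
        · simp [hr, insertRho, hT.rho_b]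
        · simp [hr, insertRho, hT.rho_c, hbc.symm]
        · simp [hr, insertRho, hT.rho_a, hab, hca.symm]
      · exact .single (by simp only [hr, insertRho, if_neg h1])
    have old : ∀ t t', G.Adj v t → G.Adj v t' → Relation.ReflTransGen r (some t) (some t') := by
      intro t t' ht ht'
      exact R.rho_induction (C := fun t' => Relation.ReflTransGen r (some t) (some t'))
        (fun w hw ih => ih.trans (step w hw)) ht .refl ht'
    have new : (G.insertVertex a b c).Adj (some v) none → ∃ t t', G.Adj v t ∧ G.Adj v t' ∧
        r (some t) none ∧ r none (some t') := by
      rw [SimpleGraph.insertVertex_some_none]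
      rintro (rfl | rfl | rfl)
      · exact ⟨c, b, hT.adj_ca.symm, hT.adj_ab, by simp [hr, insertRho],
          by simp [hr, insertRho, hab, hca.symm]⟩
      · exact ⟨a, c, hT.adj_ab.symm, hT.adj_bc, by simp [hr, insertRho],
          by simp [hr, insertRho]⟩
      · exact ⟨b, a, hT.adj_bc.symm, hT.adj_ca, by simp [hr, insertRho],
          by simp [hr, insertRho, hbc.symm]⟩
    rcases w with _ | w <;> rcases w' with _ | w'
    · exact .refl
    · obtain ⟨t, t', -, ht', -, h1⟩ := new h
      exact .head h1 (old _ _ ht' h')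
    · obtain ⟨t, t', ht, -, h1, -⟩ := new h'
      exact (old _ _ h ht).tail h1
    · exact old _ _ h h'

/-- The rotation system after the insertion of a vertex in a triangular face. -/
noncomputable def insertVertex [Finite W] {a b c : W} (hT : R.IsTriangle a b c) :
    RotationSystem (G.insertVertex a b c) :=
  ofRho _ (R.insertRho a b c) hT.insertRho_adj hT.insertRho_inj hT.insertRho_reaches

theorem insertVertex_rho [Finite W] {a b c : W} (hT : R.IsTriangle a b c) {v w : Option W}
    (h : (G.insertVertex a b c).Adj v w) :
    (R.insertVertex hT).rho v w = R.insertRho a b c v w :=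
  rho_ofRho _ _ _ _ _ h

variable {R} in
theorem IsTriangulation.insertVertex [Finite W] (hR : R.IsTriangulation) {a b c : W}
    (hT : R.IsTriangle a b c) : (R.insertVertex hT).IsTriangulation := by
  have hab := hT.adj_ab.ne
  have hbc := hT.adj_bc.ne
  have hca := hT.adj_ca.ne
  refine ⟨hR.connected.insertVertex, ?_, ?_⟩
  · intro u v h
    have h0 := hT.insertRho_adj v u h.symm
    rw [R.insertVertex_rho hT h.symm, R.insertVertex_rho hT h0.symm]
    rcases u with _ | u <;> rcases v with _ | v
    · rfl
    · rw [SimpleGraph.insertVertex_none_some] at h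
      rcases h with rfl | rfl | rfl
      · simp [insertRho, hab, hca.symm]
      · simp [insertRho]
      · simp [insertRho, hbc.symm]
    · rw [SimpleGraph.insertVertex_some_none] at h
      rcases h with rfl | rfl | rfl
      · simp [insertRho, hab, hca.symm, hbc.symm]
      · simp [insertRho, hab, hca.symm]
      · simp [insertRho, hbc.symm]
    · by_cases h1 : (v = b ∧ u = a) ∨ (v = c ∧ u = b) ∨ (v = a ∧ u = c)
      · simp only [insertRho, if_pos h1]
        rcases h1 with ⟨rfl, rfl⟩ | ⟨rfl, rfl⟩ | ⟨rfl, rfl⟩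
        · simp
        · simp [hbc.symm]
        · simp [hab, hca.symm]
      · simp only [insertRho, if_neg h1]
        have h2 : G.Adj u v := h
        have h3 := hR.rho_rho h2
        have h4 : ¬ ((R.rho v u = b ∧ v = a) ∨ (R.rho v u = c ∧ v = b) ∨
            (R.rho v u = a ∧ v = c)) := by
          rintro (⟨h5, rfl⟩ | ⟨h5, rfl⟩ | ⟨h5, rfl⟩)
          · exact h1 (.inr (.inr ⟨rfl, R.rho_inj h2.symm hT.adj_ca.symm (h5.trans hT.rho_a.symm)⟩))
          · exact h1 (.inl ⟨rfl, R.rho_inj h2.symm hT.adj_ab.symm (h5.trans hT.rho_b.symm)⟩)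
          · exact h1 (.inr (.inl ⟨rfl, R.rho_inj h2.symm hT.adj_bc.symm (h5.trans hT.rho_c.symm)⟩))
        rw [if_neg h4, h3]
  · rw [SimpleGraph.card_edgeSet_insertVertex hab hbc hca, Finite.card_option]
    have := hR.card
    omega

theorem isEmbeddedSubgraph_insertVertex [Finite W] {a b c : W} (hT : R.IsTriangle a b c) :
    IsEmbeddedSubgraph R (R.insertVertex hT) (G.copyInsertVertex a b c) := by
  rintro ⟨⟨v, w⟩, h⟩
  have h : G.Adj v w := h
  have hab := hT.adj_ab.ne
  have hbc := hT.adj_bc.ne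
  have hca := hT.adj_ca.ne
  set S := R.insertVertex hT with hS
  have hmap : ∀ {v w : W} (h : G.Adj v w), (G.copyInsertVertex a b c).toHom.mapDart ⟨(v, w), h⟩ =
      ⟨(some v, some w), h⟩ := fun h => rfl
  rw [R.next_mk h, hmap h, hmap]
  have h' : (G.insertVertex a b c).Adj (some v) (some w) := h
  have h0 : S.next ⟨(some v, some w), h'⟩ =
      ⟨(some v, R.insertRho a b c (some v) (some w)), hT.insertRho_adj _ _ h'⟩ := by
    rw [S.next_mk h']
    exact SimpleGraph.Dart.ext _ _ (by simp [hS, R.insertVertex_rho hT h'])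
  by_cases h1 : (v = b ∧ w = a) ∨ (v = c ∧ w = b) ∨ (v = a ∧ w = c)
  · have h2 : (G.insertVertex a b c).Adj (some v) none := by
      rw [SimpleGraph.insertVertex_some_none]; tauto
    have h3 : S.next ⟨(some v, some w), h'⟩ = ⟨(some v, none), h2⟩ := by
      rw [h0]
      exact SimpleGraph.Dart.ext _ _ (by simp [insertRho, h1])
    refine ⟨2, by norm_num, ?_, ?_⟩
    · rw [pow_two, Equiv.Perm.mul_apply, h3, S.next_mk h2]
      refine SimpleGraph.Dart.ext _ _ ?_
      simp only [hS, R.insertVertex_rho hT h2, Prod.mk.injEq, true_and]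
      rcases h1 with ⟨rfl, rfl⟩ | ⟨rfl, rfl⟩ | ⟨rfl, rfl⟩
      · simp [insertRho, hT.rho_b]
      · simp [insertRho, hT.rho_c, hbc.symm]
      · simp [insertRho, hT.rho_a, hab, hca.symm]
    · intro j hj hj2
      obtain rfl : j = 1 := by omega
      rw [pow_one, h3]
      rintro ⟨d, hd⟩
      have := congrArg (fun d : (G.insertVertex a b c).Dart => d.snd) hd
      cases this
  · refine ⟨1, by norm_num, ?_, by omega⟩
    rw [pow_one, h0]
    exact SimpleGraph.Dart.ext _ _ (by simp [insertRho, h1])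

variable {R} in
theorem IsTriangle.insertVertex_of_ne [Finite W] {a b c x y z : W} (hT : R.IsTriangle a b c)
    (h : R.IsTriangle x y z) (hxy : ¬ (x = a ∧ y = b)) (hyz : ¬ (y = a ∧ z = b))
    (hzx : ¬ (z = a ∧ x = b)) : (R.insertVertex hT).IsTriangle (some x) (some y) (some z) := by
  have key : ∀ {x y z : W}, R.IsTriangle x y z → ¬ (x = a ∧ y = b) → ¬ (y = a ∧ z = b) →
      ¬ (z = a ∧ x = b) → (R.insertVertex hT).rho (some y) (some x) = some z := by
    intro x y z h hxy hyz hzx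
    have h1 : (G.insertVertex a b c).Adj (some y) (some x) := h.adj_ab.symm
    rw [R.insertVertex_rho hT h1]
    have h2 : ¬ ((y = b ∧ x = a) ∨ (y = c ∧ x = b) ∨ (y = a ∧ x = c)) := by
      rintro (⟨rfl, rfl⟩ | ⟨rfl, rfl⟩ | ⟨rfl, rfl⟩)
      · exact hxy ⟨rfl, rfl⟩
      · exact hzx ⟨h.rho_b.symm.trans hT.rho_c, rfl⟩
      · exact hyz ⟨rfl, h.rho_b.symm.trans hT.rho_a⟩
    simp only [insertRho, if_neg h2, h.rho_b]
  exact ⟨h.adj_ab, h.adj_bc, h.adj_ca, key h hxy hyz hzx, key h.rotate hyz hzx hxy,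
    key h.rotate.rotate hzx hxy hyz⟩

variable {R} in
theorem IsTriangle.insertVertex_new [Finite W] (hR : R.IsTriangulation) {a b c : W}
    (hT : R.IsTriangle a b c) :
    (R.insertVertex hT).IsTriangle (some a) (some b) none ∧
      (R.insertVertex hT).IsTriangle (some b) (some c) none ∧
      (R.insertVertex hT).IsTriangle (some c) (some a) none := by
  have hR' := hR.insertVertex hT
  have key : ∀ {x y : W} (h : G.Adj x y), R.insertRho a b c (some y) (some x) = none →
      (R.insertVertex hT).IsTriangle (some x) (some y) none := by
    intro x y h e
    have h1 : (G.insertVertex a b c).Adj (some x) (some y) := h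
    exact hR'.isTriangle_of_rho h1 ((R.insertVertex_rho hT h1.symm).trans e)
  exact ⟨key hT.adj_ab (by simp [insertRho]), key hT.adj_bc (by simp [insertRho]),
    key hT.adj_ca (by simp [insertRho])⟩

end RotationSystem

namespace SimpleGraph

variable {W : Type u} {G : SimpleGraph W} {a b c : W}

theorem Walk.le_add_length {L : W → ℕ} (hL : ∀ x y, G.Adj x y → L y ≤ L x + 1) {x y : W}
    (p : G.Walk x y) : L y ≤ L x + p.length := by
  induction p with
  | nil => simp
  | cons h p ih =>
    have := hL _ _ h
    rw [Walk.length_cons]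
    omega

theorem Connected.le_add_dist (hc : G.Connected) {L : W → ℕ}
    (hL : ∀ x y, G.Adj x y → L y ≤ L x + 1) (x y : W) : L y ≤ L x + G.dist x y := by
  obtain ⟨p, hp⟩ := hc.exists_walk_length_eq_dist x y
  rw [← hp]
  exact p.le_add_length hL

theorem Connected.dist_le_dist_add_one (hc : G.Connected) {v w : W} (h : G.Adj v w) (u : W) :
    G.dist u w ≤ G.dist u v + 1 := by
  have := hc.dist_triangle (u := u) (v := v) (w := w)
  rwa [dist_eq_one_iff_adj.2 h] at this

/-- The distances after the insertion of a vertex in a triangle. -/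
theorem dist_insertVertex (hc : G.Connected) (hab : G.Adj a b) (hbc : G.Adj b c)
    (hca : G.Adj c a) (v : W) :
    (∀ w, (G.insertVertex a b c).dist (some v) (some w) = G.dist v w) ∧
      (G.insertVertex a b c).dist (some v) none =
        min (G.dist v a) (min (G.dist v b) (G.dist v c)) + 1 := by
  have hc' : (G.insertVertex a b c).Connected := hc.insertVertex
  have hab1 := hc.dist_le_dist_add_one hab v
  have hab2 := hc.dist_le_dist_add_one hab.symm v
  have hbc1 := hc.dist_le_dist_add_one hbc v
  have hbc2 := hc.dist_le_dist_add_one hbc.symm v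
  have hca1 := hc.dist_le_dist_add_one hca v
  have hca2 := hc.dist_le_dist_add_one hca.symm v
  obtain ⟨L, hLs, hLn⟩ : ∃ L : Option W → ℕ, (∀ w, L (some w) = G.dist v w) ∧
      L none = min (G.dist v a) (min (G.dist v b) (G.dist v c)) + 1 :=
    ⟨fun x => x.elim (min (G.dist v a) (min (G.dist v b) (G.dist v c)) + 1) (G.dist v),
      fun _ => rfl, rfl⟩
  have hL : ∀ x y, (G.insertVertex a b c).Adj x y → L y ≤ L x + 1 := by
    rintro (_ | x) (_ | y) h
    · omega
    · rw [hLs, hLn]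
      rcases h with rfl | rfl | rfl <;> omega
    · rw [hLs, hLn]
      rcases h with rfl | rfl | rfl <;> omega
    · rw [hLs, hLs]
      exact hc.dist_le_dist_add_one h v
  have key := hc'.le_add_dist hL (some v)
  simp only [hLs, dist_self, zero_add] at key
  have hle : ∀ w, (G.insertVertex a b c).dist (some v) (some w) ≤ G.dist v w :=
    fun w => (G.copyInsertVertex a b c).dist_le hc v w
  refine ⟨fun w => le_antisymm (hle w) ?_, le_antisymm ?_ ?_⟩
  · rw [← hLs]
    exact key _
  · have h1 := hc'.dist_le_dist_add_one (v := some a) (w := none) (.inl rfl) (some v)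
    have h2 := hc'.dist_le_dist_add_one (v := some b) (w := none) (.inr (.inl rfl)) (some v)
    have h3 := hc'.dist_le_dist_add_one (v := some c) (w := none) (.inr (.inr rfl)) (some v)
    have := hle a
    have := hle b
    have := hle c
    omega
  · rw [← hLn]
    exact key _

theorem Connected.eccent_eq_iff [Finite W] (hc : G.Connected) (v : W) (n : ℕ) :
    G.eccent v = n ↔ (∀ w, G.dist v w ≤ n) ∧ ∃ w, G.dist v w = n := by
  have hd : ∀ w, G.edist v w = G.dist v w :=
    fun w => (hc.preconnected v w).coe_dist_eq_edist.symm
  obtain ⟨x, hx⟩ := G.exists_edist_eq_eccent_of_finite v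
  constructor
  · intro h
    refine ⟨fun w => ?_, x, ?_⟩
    · have h1 : G.edist v w ≤ G.eccent v := edist_le_eccent
      rw [h, hd] at h1
      exact_mod_cast h1
    · rw [h, hd] at hx
      exact_mod_cast hx
  · rintro ⟨h1, w, h2⟩
    refine le_antisymm ((eccent_le_iff v n).2 fun w => ?_) ?_
    · rw [hd]
      exact_mod_cast h1 w
    · rw [← h2, ← hd]
      exact edist_le_eccent

end SimpleGraph

theorem IsEmbeddedSubgraph.refl {V : Type u} {H : SimpleGraph V} (R : RotationSystem H) :
    IsEmbeddedSubgraph R R (SimpleGraph.Copy.id H) :=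
  fun _ => ⟨1, one_pos, rfl, by omega⟩

theorem IsEmbeddedSubgraph.trans {V W X : Type u} {H : SimpleGraph V} {G : SimpleGraph W}
    {K : SimpleGraph X} {R : RotationSystem H} {S : RotationSystem G} {T : RotationSystem K}
    {ι : SimpleGraph.Copy H G} {κ : SimpleGraph.Copy G K} (hι : IsEmbeddedSubgraph R S ι)
    (hκ : IsEmbeddedSubgraph S T κ) : IsEmbeddedSubgraph R T (κ.comp ι) := by
  have key : ∀ (g : G.Dart) (n : ℕ), ∃ m, (0 < n ↔ 0 < m) ∧
      (T.next ^ m) (κ.toHom.mapDart g) = κ.toHom.mapDart ((S.next ^ n) g) ∧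
      ∀ i, 0 < i → i < m → ∀ g', κ.toHom.mapDart g' = (T.next ^ i) (κ.toHom.mapDart g) →
        ∃ l, 0 < l ∧ l < n ∧ g' = (S.next ^ l) g := by
    intro g n
    induction n with
    | zero => exact ⟨0, by simp, rfl, by omega⟩
    | succ n ih =>
      obtain ⟨m, hm0, hm, hm'⟩ := ih
      obtain ⟨k, hk0, hk, hk'⟩ := hκ ((S.next ^ n) g)
      refine ⟨k + m, by omega, ?_, fun i hi him g' hg' => ?_⟩
      · rw [pow_add, Equiv.Perm.mul_apply, hm, hk, pow_succ', Equiv.Perm.mul_apply]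
      · rcases lt_trichotomy i m with h | rfl | h
        · obtain ⟨l, hl, hl', rfl⟩ := hm' i hi h g' hg'
          exact ⟨l, hl, by omega, rfl⟩
        · rw [hm] at hg'
          exact ⟨n, by omega, by omega, κ.mapDart_injective hg'⟩
        · have hr : (T.next ^ i) (κ.toHom.mapDart g) ∈ Set.range κ.toHom.mapDart := ⟨g', hg'⟩
          refine absurd hr ?_
          rw [← Nat.sub_add_cancel h.le, pow_add, Equiv.Perm.mul_apply, hm]
          exact hk' _ (by omega) (by omega)
  intro d
  obtain ⟨n, hn0, hn, hn'⟩ := hι d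
  obtain ⟨m, hm0, hm, hm'⟩ := key (ι.toHom.mapDart d) n
  refine ⟨m, hm0.1 hn0, ?_, ?_⟩
  · rw [hn] at hm
    exact hm
  · rintro i hi him ⟨e, he⟩
    obtain ⟨l, hl, hl', h⟩ := hm' i hi him (ι.toHom.mapDart e) he
    exact hn' l hl hl' ⟨e, h⟩

namespace RotationSystem

variable {V W : Type u} {G : SimpleGraph W}

/-- Among the vertices `ι v`, the vertex `ι u` is quasi-eccentric with respect to some triangular
face, and the sum of its distances to the vertices of this triangle is at least `n`. -/
def HasQuasiEccentricFace (R : RotationSystem G) (ι : V → W) (u : V) (n : ℕ) : Prop :=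
  ∃ x y z, R.IsTriangle x y z ∧
    (∀ v, G.dist (ι v) x ≤ G.dist (ι u) x ∨ G.dist (ι v) y ≤ G.dist (ι u) y ∨
      G.dist (ι v) z ≤ G.dist (ι u) z) ∧
    n ≤ G.dist (ι u) x + G.dist (ι u) y + G.dist (ι u) z

variable {R : RotationSystem G} {ι : V → W} {u : V}

theorem HasQuasiEccentricFace.mono {m n : ℕ} (h : R.HasQuasiEccentricFace ι u n) (hmn : m ≤ n) :
    R.HasQuasiEccentricFace ι u m :=
  let ⟨x, y, z, hT, h1, h2⟩ := h
  ⟨x, y, z, hT, h1, hmn.trans h2⟩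

theorem IsTriangulation.hasQuasiEccentricFace_insertVertex_succ [Finite W]
    (hR : R.IsTriangulation) {a b c : W} (hT : R.IsTriangle a b c)
    (h : ∀ v, G.dist (ι v) a ≤ G.dist (ι u) a ∨ G.dist (ι v) b ≤ G.dist (ι u) b ∨
      G.dist (ι v) c ≤ G.dist (ι u) c) :
    (R.insertVertex hT).HasQuasiEccentricFace (some ∘ ι) u
      (G.dist (ι u) a + G.dist (ι u) b + G.dist (ι u) c + 1) := by
  have hd := fun v => SimpleGraph.dist_insertVertex hR.connected hT.adj_ab hT.adj_bc hT.adj_ca (ι v)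
  obtain ⟨h1, h2, h3⟩ := IsTriangle.insertVertex_new hR hT
  obtain hmin | hmin | hmin :
      (G.dist (ι u) c ≤ G.dist (ι u) a ∧ G.dist (ι u) c ≤ G.dist (ι u) b) ∨
      (G.dist (ι u) a ≤ G.dist (ι u) b ∧ G.dist (ι u) a ≤ G.dist (ι u) c) ∨
      (G.dist (ι u) b ≤ G.dist (ι u) c ∧ G.dist (ι u) b ≤ G.dist (ι u) a) := by omega
  · refine ⟨_, _, _, h1, fun v => ?_, ?_⟩
    · have := h v
      simp only [Function.comp_apply, (hd _).1, (hd _).2]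
      omega
    · simp only [Function.comp_apply, (hd _).1, (hd _).2]
      omega
  · refine ⟨_, _, _, h2, fun v => ?_, ?_⟩
    · have := h v
      simp only [Function.comp_apply, (hd _).1, (hd _).2]
      omega
    · simp only [Function.comp_apply, (hd _).1, (hd _).2]
      omega
  · refine ⟨_, _, _, h3, fun v => ?_, ?_⟩
    · have := h v
      simp only [Function.comp_apply, (hd _).1, (hd _).2]
      omega
    · simp only [Function.comp_apply, (hd _).1, (hd _).2]
      omega

theorem IsTriangulation.hasQuasiEccentricFace_insertVertex [Finite W]
    (hR : R.IsTriangulation) {a b c : W} (hT : R.IsTriangle a b c) {n : ℕ}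
    (h : R.HasQuasiEccentricFace ι u n) :
    (R.insertVertex hT).HasQuasiEccentricFace (some ∘ ι) u n := by
  obtain ⟨x, y, z, hxyz, hq, hn⟩ := h
  by_cases hxy : x = a ∧ y = b
  · obtain ⟨rfl, rfl⟩ := hxy
    obtain rfl : z = c := hxyz.rho_b.symm.trans hT.rho_b
    exact (hR.hasQuasiEccentricFace_insertVertex_succ hT hq).mono (by omega)
  by_cases hyz : y = a ∧ z = b
  · obtain ⟨rfl, rfl⟩ := hyz
    obtain rfl : x = c := hxyz.rho_c.symm.trans hT.rho_b
    refine (hR.hasQuasiEccentricFace_insertVertex_succ (u := u) (ι := ι) hT fun v => ?_).mono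
      (by omega)
    have := hq v
    tauto
  by_cases hzx : z = a ∧ x = b
  · obtain ⟨rfl, rfl⟩ := hzx
    obtain rfl : y = c := hxyz.rho_a.symm.trans hT.rho_b
    refine (hR.hasQuasiEccentricFace_insertVertex_succ (u := u) (ι := ι) hT fun v => ?_).mono
      (by omega)
    have := hq v
    tauto
  · have hd := fun v =>
      SimpleGraph.dist_insertVertex hR.connected hT.adj_ab hT.adj_bc hT.adj_ca (ι v)
    refine ⟨_, _, _, hT.insertVertex_of_ne hxyz hxy hyz hzx, fun v => ?_, ?_⟩
    · simpa only [Function.comp_apply, (hd _).1] using hq v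
    · simpa only [Function.comp_apply, (hd _).1] using hn

/-- If every vertex `ι u` of a triangulation has eccentricity `α` or is quasi-eccentric with respect
to a face, then the triangulation extends to one in which all these eccentricities are `α`. The
induction is on the sum of the numbers `g u`, which bound how much the sum of the distances from
`ι u` to its face can still grow. -/
theorem IsTriangulation.exists_extension {V : Type u} [Fintype V] {α : ℕ} (N : ℕ) :
    ∀ {W : Type u} [Finite W] {G : SimpleGraph W} {R : RotationSystem G} (_ : R.IsTriangulation)
      (ι : V → W) (g : V → ℕ), ∑ u, g u ≤ N → (∀ v w, G.dist (ι v) w ≤ α) →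
      (∀ u, (∃ w, G.dist (ι u) w = α) ∨ R.HasQuasiEccentricFace ι u (3 * α - g u)) →
      ∃ (W' : Type u) (_ : Finite W') (G' : SimpleGraph W') (R' : RotationSystem G')
        (κ : SimpleGraph.Copy G G'), IsEmbeddedSubgraph R R' κ ∧ R'.IsTriangulation ∧
          ∀ u, G'.eccent (κ (ι u)) = α := by
  classical
  induction N with
  | zero =>
    intro W _ G R hR ι g hg hle h
    refine ⟨W, inferInstance, G, R, SimpleGraph.Copy.id G, .refl R, hR, fun u => ?_⟩
    refine (hR.connected.eccent_eq_iff _ _).2 ⟨hle u, ?_⟩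
    change ∃ w, G.dist (ι u) w = α
    rcases h u with h | ⟨x, y, z, -, -, hn⟩
    · exact h
    · have h0 : g u = 0 := by
        have := Finset.single_le_sum (f := g) (fun _ _ => Nat.zero_le _) (Finset.mem_univ u)
        omega
      have := hle u x
      have := hle u y
      have := hle u z
      exact ⟨x, by omega⟩
  | succ N ih =>
    intro W _ G R hR ι g hg hle h
    by_cases hall : ∀ u, ∃ w, G.dist (ι u) w = α
    · exact ⟨W, inferInstance, G, R, SimpleGraph.Copy.id G, .refl R, hR,
        fun u => (hR.connected.eccent_eq_iff _ _).2 ⟨hle u, hall u⟩⟩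
    push Not at hall
    obtain ⟨u₀, hu₀⟩ := hall
    have hlt : ∀ w, G.dist (ι u₀) w < α := fun w => lt_of_le_of_ne (hle _ _) (hu₀ w)
    obtain ⟨a, b, c, hT, hq, hn⟩ := (h u₀).resolve_left fun ⟨w, hw⟩ => hu₀ w hw
    have ha := hlt a
    have hb := hlt b
    have hc := hlt c
    have hd := fun v =>
      SimpleGraph.dist_insertVertex hR.connected hT.adj_ab hT.adj_bc hT.adj_ca (ι v)
    have hsum : ∑ u, Function.update g u₀ (g u₀ - 1) u ≤ N := by
      rw [Finset.sum_update_of_mem (Finset.mem_univ _)]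
      have := Finset.add_sum_erase Finset.univ g (Finset.mem_univ u₀)
      rw [← Finset.erase_eq]
      omega
    have hle' : ∀ v w, (G.insertVertex a b c).dist ((some ∘ ι) v) w ≤ α := by
      rintro v (_ | w)
      · have := hq v
        rw [Function.comp_apply, (hd v).2]
        omega
      · rw [Function.comp_apply, (hd v).1]
        exact hle v w
    obtain ⟨W', hW', G', R', κ, hκ, hR', hκα⟩ := ih (hR.insertVertex hT) (some ∘ ι)
      (Function.update g u₀ (g u₀ - 1)) hsum hle' <| by
        intro u
        rcases eq_or_ne u u₀ with rfl | hu
        · right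
          refine (hR.hasQuasiEccentricFace_insertVertex_succ hT hq).mono ?_
          rw [Function.update_self]
          omega
        · rw [Function.update_of_ne hu]
          rcases h u with ⟨w, hw⟩ | h
          · exact .inl ⟨some w, by rw [Function.comp_apply, (hd u).1, hw]⟩
          · exact .inr (hR.hasQuasiEccentricFace_insertVertex hT h)
    exact ⟨W', hW', G', R', κ.comp (G.copyInsertVertex a b c),
      (R.isEmbeddedSubgraph_insertVertex hT).trans hκ, hR', hκα⟩

theorem IsTriangle.mem_of_sameCycle [Finite W] {x y z : W} (hT : R.IsTriangle x y z)
    {e : G.Dart} (h : R.faceNext.SameCycle ⟨(x, y), hT.adj_ab⟩ e) :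
    e.fst = x ∨ e.fst = y ∨ e.fst = z := by
  have : Finite G.Dart := Finite.of_injective _ SimpleGraph.Dart.toProd_injective
  obtain ⟨n, rfl⟩ := h.exists_nat_pow_eq
  have key : ∀ n : ℕ, (R.faceNext ^ n) ⟨(x, y), hT.adj_ab⟩ = ⟨(x, y), hT.adj_ab⟩ ∨
      (R.faceNext ^ n) ⟨(x, y), hT.adj_ab⟩ = ⟨(y, z), hT.adj_bc⟩ ∨
      (R.faceNext ^ n) ⟨(x, y), hT.adj_ab⟩ = ⟨(z, x), hT.adj_ca⟩ := by
    intro n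
    induction n with
    | zero => exact .inl rfl
    | succ n ih =>
      rw [pow_succ', Equiv.Perm.mul_apply]
      rcases ih with h | h | h <;> rw [h, R.faceNext_mk]
      · exact .inr (.inl (SimpleGraph.Dart.ext _ _ (by simp [hT.rho_b])))
      · exact .inr (.inr (SimpleGraph.Dart.ext _ _ (by simp [hT.rho_c])))
      · exact .inl (SimpleGraph.Dart.ext _ _ (by simp [hT.rho_a]))
  rcases key n with h | h | h <;> simp [h]

/-- The rotation system of a triangle. -/
noncomputable def triangle : RotationSystem (⊤ : SimpleGraph (ULift.{u} (Fin 3))) :=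
  ofRho _ (fun v w => ⟨-(v.down + w.down)⟩)
    (by
      rintro ⟨v⟩ ⟨w⟩ h
      simp only [SimpleGraph.top_adj, ne_eq, ULift.up.injEq] at h ⊢
      revert v w
      decide)
    (by
      rintro ⟨v⟩ ⟨w⟩ ⟨w'⟩ - - h
      simpa using h)
    (by
      rintro ⟨v⟩ ⟨w⟩ ⟨w'⟩ h h'
      simp only [SimpleGraph.top_adj, ne_eq, ULift.up.injEq] at h h'
      have : w = w' ∨ -(v + w) = w' := by
        revert v w w'
        decide
      rcases this with rfl | rfl
      · exact .refl
      · exact .single rfl)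

theorem triangle_rho {v w : ULift.{u} (Fin 3)} (h : v ≠ w) :
    triangle.rho v w = ⟨-(v.down + w.down)⟩ :=
  rho_ofRho _ _ _ _ _ h

theorem triangle_rho_ne {v w : ULift.{u} (Fin 3)} (h : v ≠ w) :
    triangle.rho v w ≠ v ∧ triangle.rho v w ≠ w := by
  rw [triangle_rho h]
  obtain ⟨v⟩ := v
  obtain ⟨w⟩ := w
  simp only [ne_eq, ULift.up.injEq] at h ⊢
  revert v w
  decide

theorem isTriangulation_triangle : (triangle.{u}).IsTriangulation := by
  refine ⟨SimpleGraph.connected_top, ?_, ?_⟩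
  · intro x y h
    have h1 : y ≠ x := h.symm
    rw [triangle_rho (triangle_rho_ne h1).1, triangle_rho h1]
    ext1
    simp
  · have h1 : Nat.card (⊤ : SimpleGraph (ULift.{u} (Fin 3))).edgeSet = 3 := by
      rw [Nat.card_eq_fintype_card, ← SimpleGraph.edgeFinset_card,
        SimpleGraph.card_edgeFinset_top_eq_card_choose_two]
      simp
    rw [h1]
    simp

theorem isEmbeddedSubgraph_triangle [Finite V] (hV : Nat.card V ≤ 2) {H : SimpleGraph V}
    (S : RotationSystem H) (ι : SimpleGraph.Copy H (⊤ : SimpleGraph (ULift.{u} (Fin 3)))) :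
    IsEmbeddedSubgraph S triangle ι := by
  have hthree : ∀ {x y z : V}, x ≠ y → z ≠ x → z ≠ y → False := by
    intro x y z hxy hzx hzy
    have h1 : ({x, y, z} : Set V).ncard = 3 :=
      Set.ncard_eq_three.2 ⟨x, y, z, hxy, hzx.symm, hzy.symm, rfl⟩
    have h2 := Set.ncard_le_card ({x, y, z} : Set V)
    omega
  rintro ⟨⟨v, w⟩, h⟩
  have h : H.Adj v w := h
  have hS : S.rho v w = w := by
    by_contra hne
    exact hthree h.ne (S.adj_rho h).ne' hne
  have hvw : ι v ≠ ι w := ι.injective.ne h.ne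
  have h1 := triangle_rho_ne hvw
  have hmap : ∀ {v w : V} (h : H.Adj v w), ι.toHom.mapDart ⟨(v, w), h⟩ =
      ⟨(ι v, ι w), ι.toHom.map_adj h⟩ := fun h => rfl
  rw [S.next_mk h, hmap, hmap]
  refine ⟨2, by norm_num, ?_, ?_⟩
  · rw [pow_two, Equiv.Perm.mul_apply, triangle.next_mk, triangle.next_mk]
    refine SimpleGraph.Dart.ext _ _ ?_
    simp only [Prod.mk.injEq, true_and]
    rw [hS, triangle_rho h1.1.symm, triangle_rho hvw]
    ext1
    simp
  · intro j hj hj2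
    obtain rfl : j = 1 := by omega
    rw [pow_one, triangle.next_mk]
    rintro ⟨⟨⟨x, y⟩, hxy⟩, he⟩
    have he := congrArg SimpleGraph.Dart.toProd he
    obtain ⟨he1, he2⟩ := Prod.mk.inj he
    have he2 : ι y = triangle.rho (ι v) (ι w) := he2
    refine hthree h.ne (z := y) ?_ ?_
    · rintro rfl
      exact h1.1 he2.symm
    · rintro rfl
      exact h1.2 he2.symm

end RotationSystem

theorem MaximalPlaneGraph.exists_isTriangle {V : Type u} [Finite V] {H : MaximalPlaneGraph V}
    (hH : H.rot.IsTriangulation) (f : H.rot.Face) : ∃ x y z, H.rot.IsTriangle x y z ∧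
      ∀ v ∈ H.rot.boundary f, v = x ∨ v = y ∨ v = z := by
  have := hH.nontrivial
  rcases f with q | ⟨v, hv⟩
  · induction q using Quotient.inductionOn with
    | h d =>
      obtain ⟨⟨x, y⟩, h⟩ := d
      have hT := hH.isTriangle h
      refine ⟨x, y, _, hT, ?_⟩
      rintro _ ⟨e, he, rfl⟩
      exact hT.mem_of_sameCycle (Quotient.exact he.symm)
  · obtain ⟨w, hw⟩ := hH.connected.preconnected.exists_adj_of_nontrivial v
    exact absurd hw (hv w)

theorem MaximalPlaneGraph.exists_supergraph {V : Type u} [Finite V] (H : MaximalPlaneGraph V)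
    {α : ℕ} (hα : H.graph.ediam ≤ α) (h : ∀ u : V, H.graph.eccent u < α →
      ∃ f : H.rot.Face, u ∈ quasiEccentric H.graph (H.rot.boundary f)) :
    ∃ (W : Type u) (_ : Finite W) (G : MaximalPlaneGraph W) (ι : SimpleGraph.Copy H.graph G.graph),
      IsEmbeddedSubgraph H.rot G.rot ι ∧ ∀ v : V, G.graph.eccent (ι v) = α := by
  have := Fintype.ofFinite V
  have hecc : ∀ u, H.graph.eccent u ≤ α := fun u => SimpleGraph.eccent_le_ediam.trans hα
  by_cases hall : ∀ u, H.graph.eccent u = α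
  · exact ⟨V, inferInstance, H, SimpleGraph.Copy.id _, .refl _, hall⟩
  push Not at hall
  obtain ⟨u₀, hu₀⟩ := hall
  have hlt : H.graph.eccent u₀ < α := lt_of_le_of_ne (hecc u₀) hu₀
  have hα0 : 0 < α := by
    rcases Nat.eq_zero_or_pos α with rfl | h0
    · simp at hlt
    · exact h0
  have : Nonempty V := ⟨u₀⟩
  have hc : H.graph.Connected := SimpleGraph.connected_of_ediam_ne_top fun h => by simp [h] at hα
  have hd : ∀ u v, H.graph.edist u v = H.graph.dist u v :=
    fun u v => (hc.preconnected u v).coe_dist_eq_edist.symm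
  rcases Nat.lt_or_ge 2 (Nat.card V) with hn | hn
  · have hH := H.isTriangulation hc hn
    have hle : ∀ v w, H.graph.dist (id v) w ≤ α := by
      intro v w
      have h1 : H.graph.edist v w ≤ α := SimpleGraph.edist_le_eccent.trans (hecc v)
      rw [hd] at h1
      exact_mod_cast h1
    obtain ⟨W, hW, G, R, κ, hκ, hR, hecc'⟩ := RotationSystem.IsTriangulation.exists_extension
      (α := α) _ hH id (fun _ => 3 * α) le_rfl hle <| by
        intro u
        rcases (hecc u).lt_or_eq with hu | hu
        · right
          obtain ⟨f, hf⟩ := h u hu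
          obtain ⟨x, y, z, hT, hbd⟩ := H.exists_isTriangle hH f
          refine ⟨x, y, z, hT, fun v => ?_, by omega⟩
          obtain ⟨s, hs, hsd⟩ := hf v
          rw [hd, hd, Nat.cast_le] at hsd
          rcases hbd s hs with rfl | rfl | rfl
          · exact .inl hsd
          · exact .inr (.inl hsd)
          · exact .inr (.inr hsd)
        · exact .inl ((hc.eccent_eq_iff u α).1 hu).2
    exact ⟨W, hW, hR.toMaximalPlaneGraph, κ, hκ, hecc'⟩
  · obtain ⟨f⟩ : Nonempty (V ↪ ULift.{u} (Fin 3)) := by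
      refine Function.Embedding.nonempty_of_card_le ?_
      rw [Nat.card_eq_fintype_card] at hn
      simp
      omega
    set ι : SimpleGraph.Copy H.graph (⊤ : SimpleGraph (ULift.{u} (Fin 3))) :=
      ⟨⟨f, fun h => f.injective.ne h.ne⟩, f.injective⟩ with hι
    have hR := RotationSystem.isTriangulation_triangle.{u}
    have hle : ∀ v w, (⊤ : SimpleGraph (ULift.{u} (Fin 3))).dist (ι v) w ≤ α := by
      intro v w
      rw [SimpleGraph.dist_top]
      split_ifs <;> omega
    obtain ⟨W, hW, G, R, κ, hκ, hR', hecc'⟩ := RotationSystem.IsTriangulation.exists_extension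
      (α := α) _ hR ι (fun _ => 3 * α) le_rfl hle <| by
        intro u
        right
        obtain ⟨y, hy⟩ := exists_ne (ι u)
        have hT := hR.isTriangle (a := ι u) (b := y) hy.symm
        refine ⟨_, _, _, hT, fun v => ?_, by omega⟩
        have hv : ι v = ι u ∨ ι v = y ∨ ι v = RotationSystem.triangle.rho y (ι u) := by
          rw [RotationSystem.triangle_rho hy]
          have key : ∀ a b c : Fin 3, b ≠ a → c = a ∨ c = b ∨ c = -(b + a) := by decide
          rcases key (ι u).down y.down (ι v).down fun h => hy (ULift.ext _ _ h) with h | h | h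
          · exact .inl (ULift.ext _ _ h)
          · exact .inr (.inl (ULift.ext _ _ h))
          · exact .inr (.inr (ULift.ext _ _ h))
        rcases hv with h | h | h
        · left; rw [h]
        · right; left; rw [h, SimpleGraph.dist_self]; omega
        · right; right; rw [h, SimpleGraph.dist_self]; omega
    exact ⟨W, hW, hR'.toMaximalPlaneGraph, κ.comp ι,
      (RotationSystem.isEmbeddedSubgraph_triangle hn _ ι).trans hκ, hecc'⟩

theorem mainTheorem1 {V : Type u} [Finite V] (H : MaximalPlaneGraph V) (α : ℕ)
    (hα : H.graph.ediam ≤ (α : ℕ∞)) :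
    (∃ (W : Type u) (_ : Finite W) (G : MaximalPlaneGraph W)
        (ι : SimpleGraph.Copy H.graph G.graph),
        IsEmbeddedSubgraph H.rot G.rot ι ∧ ∀ v : V, G.graph.eccent (ι v) = (α : ℕ∞)) ↔
      ∀ u : V, H.graph.eccent u < (α : ℕ∞) →
        ∃ f : H.rot.Face, u ∈ quasiEccentric H.graph (H.rot.boundary f) := by
  constructor
  · rintro ⟨W, _, G, ι, hι, hecc⟩ u hu
    have : Nonempty V := ⟨u⟩
    have hH : H.graph.Connected :=
      SimpleGraph.connected_of_ediam_ne_top fun h => by simp [h] at hα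
    exact H.exists_quasiEccentric hH hι hecc u hu
  · exact H.exists_supergraph hα
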